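/- Let $n\ge 0$ and let $G=[g_{jk}]$ be a $2n\times 2n$ random matrix with (real or complex) entries. Suppose that $G$ is sign-symmetric in the following sense: for every entry $(j,k)$, the joint distribution of the entries of $G$ is unchanged when $g_{jk}$ is replaced by $-g_{jk}$, possibly with the simultaneous negation of some other entries of the same row $j$. (This holds, for example, if the entries are independent and each $g_{jk}$ has the same distribution as $-g_{jk}$, or if the distribution of $G$ is invariant under left multiplication by orthogonal matrices.) Suppose that the averages $$p_{2n}(z)=\langle\det(z\mathbb I_{2n}-G)\rangle,\qquad p_{2n+1}(z)=z\,p_{2n}(z)+\langle\det(z\mathbb I_{2n}-G)\,\mathrm{Tr}\,G\rangle$$ exist (converge absolutely) for all $z\in\mathbb C$. Then $\langle\mathrm{Tr}\,G^2\rangle$ exists and, for all $z\in\mathbb C$, $$p_{2n}(z)=z^{2n},\qquad p_{2n+1}(z)=z^{2n+1}-\langle\mathrm{Tr}\,G^2\rangle\,z^{2n-1}$$ (for $n=0$, where $\mathrm{Tr}\,G^2=0$, the last term is absent). Let now, for each $n\ge0$, $G$ be a $2n\times 2n$ GinOE matrix, i.e. its entries are independent real standard normal variables, and let $p_{2n},p_{2n+1}$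 be the above averages. These averages exist, $\langle\mathrm{Tr}\,G^2\rangle=2n$, and $$p_{2n}(z)=z^{2n},\qquad p_{2n+1}(z)=z^{2n+1}-2n\,z^{2n-1}=-e^{z^2/2}\frac{d}{dz}\Big(e^{-z^2/2}p_{2n}(z)\Big).$$ Moreover, with the weight $\omega(z)=e^{-|z|^2}e^{2y^2}\,\mathrm{erfc}(\sqrt2\,y)$, $z=x+iy$, and the skew inner product $$\langle f,g\rangle=\int_{-\infty}^\infty\!dx\int_{-\infty}^\infty\!dy\,(\omega(x)\omega(y))^{1/2}f(x)g(y)\,\mathrm{sgn}(y-x)+2i\int_{\mathrm{Im}\,z>0}\!d^2z\,\omega(z)\big(f(z)g(\bar z)-g(z)f(\bar z)\big),$$ the monic polynomials $p_0,p_1,p_2,\dots$ (with $\deg p_j=j$) are skew-orthogonal: all the integrals $\langle p_j,p_k\rangle$ converge absolutely and, for all $j,k\ge1$, $$\langle p_{2j-1},p_{2k-1}\rangle=\langle p_{2j-2},p_{2k-2}\rangle=0,\qquad \langle p_{2j-2},p_{2k-1}\rangle=-\langle p_{2k-1},p_{2j-2}\rangle=r_{j-1}\delta_{jk},$$ with skew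 norms $r_{n-1}=2\sqrt{2\pi}\,\Gamma(2n-1)$ for $n\ge1$. -/

import Mathlib

open MeasureTheory ProbabilityTheory

/-- Matrices carry the product σ-algebra of their entries. -/
instance matrixMeasurableSpace {m n α : Type*} [MeasurableSpace α] :
    MeasurableSpace (Matrix m n α) :=
  inferInstanceAs (MeasurableSpace (m → n → α))

/-- The matrix obtained from `A` by negating the entries `A j l`, `l ∈ s`, of row `j`. -/
def negateInRow {N : ℕ} (j : Fin N) (s : Finset (Fin N)) (A : Matrix (Fin N) (Fin N) ℂ) :
    Matrix (Fin N) (Fin N) ℂ :=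
  Matrix.of fun i l => if i = j ∧ l ∈ s then -A i l else A i l

/-- Sign symmetry of a random matrix: the law of `G` is unchanged when any given entry `G j k` is
negated, possibly together with some other entries of the same row `j`. The case `s = {k}` is
invariance of the law under negating the single entry (for example independent entries that are
symmetrically distributed); the case `s = univ` is invariance under negating a whole row (for
example matrices whose law is invariant under left multiplication by orthogonal matrices). -/
def SignSymmetric {Ω : Type*} [MeasurableSpace Ω] {N : ℕ} (μ : Measure Ω)
    (G : Ω → Matrix (Fin N) (Fin N) ℂ) : Prop :=
  ∀ j k : Fin N, ∃ s : Finset (Fin N), k ∈ s ∧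
    IdentDistrib (fun ω => negateInRow j s (G ω)) G μ μ

/-- The characteristic polynomial `det (z 𝕀 - A)` at the point `z`. -/
noncomputable def charDet {N : ℕ} (z : ℂ) (A : Matrix (Fin N) (Fin N) ℂ) : ℂ :=
  (z • (1 : Matrix (Fin N) (Fin N) ℂ) - A).det

/-- `⟨det (z 𝕀 - G)⟩`. -/
noncomputable def evenAverage {Ω : Type*} [MeasurableSpace Ω] {N : ℕ} (μ : Measure Ω)
    (G : Ω → Matrix (Fin N) (Fin N) ℂ) (z : ℂ) : ℂ :=
  ∫ ω, charDet z (G ω) ∂μ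

/-- `z ⟨det (z 𝕀 - G)⟩ + ⟨det (z 𝕀 - G) Tr G⟩`. -/
noncomputable def oddAverage {Ω : Type*} [MeasurableSpace Ω] {N : ℕ} (μ : Measure Ω)
    (G : Ω → Matrix (Fin N) (Fin N) ℂ) (z : ℂ) : ℂ :=
  z * evenAverage μ G z + ∫ ω, charDet z (G ω) * (G ω).trace ∂μ

/-- The averages in `evenAverage` and `oddAverage` exist for all `z`. -/
def AveragesExist {Ω : Type*} [MeasurableSpace Ω] {N : ℕ} (μ : Measure Ω)
    (G : Ω → Matrix (Fin N) (Fin N) ℂ) : Prop :=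
  ∀ z : ℂ, Integrable (fun ω => charDet z (G ω)) μ ∧
    Integrable (fun ω => charDet z (G ω) * (G ω).trace) μ

/-- The law of an `N × N` GinOE matrix: independent real standard normal entries. -/
noncomputable def ginOE (N : ℕ) : Measure (Matrix (Fin N) (Fin N) ℝ) :=
  Measure.pi fun _ : Fin N => Measure.pi fun _ : Fin N => gaussianReal 0 1

/-- A real matrix regarded as a complex one. -/
noncomputable def toComplexMatrix {N : ℕ} (A : Matrix (Fin N) (Fin N) ℝ) :
    Matrix (Fin N) (Fin N) ℂ :=
  A.map Complex.ofReal

/-- The sequence of functions `p_{2n}`, `p_{2n+1}` given by averages over `2n × 2n` GinOE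
matrices. -/
noncomputable def ginOEPoly (m : ℕ) : ℂ → ℂ :=
  if Even m then evenAverage (ginOE (2 * (m / 2))) toComplexMatrix
  else oddAverage (ginOE (2 * (m / 2))) toComplexMatrix

/-- The complementary error function. -/
noncomputable def erfc (t : ℝ) : ℝ :=
  2 / Real.sqrt Real.pi * ∫ s in Set.Ioi t, Real.exp (-s ^ 2)

/-- The weight `e^{-|z|²} e^{2 y²} erfc (√2 y)`, `z = x + i y`. -/
noncomputable def ginWeight (z : ℂ) : ℝ :=
  Real.exp (-‖z‖ ^ 2) * Real.exp (2 * z.im ^ 2) * erfc (Real.sqrt 2 * z.im)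

/-- The integrand of the real part of the skew inner product. -/
noncomputable def skewRealIntegrand (f g : ℂ → ℂ) (x y : ℝ) : ℂ :=
  (Real.sqrt (ginWeight x * ginWeight y) : ℂ) * f x * g y * (Real.sign (y - x) : ℂ)

/-- The integrand of the complex part of the skew inner product. -/
noncomputable def skewComplexIntegrand (f g : ℂ → ℂ) (z : ℂ) : ℂ :=
  (ginWeight z : ℂ) *
    (f z * g (starRingEnd ℂ z) - g z * f (starRingEnd ℂ z))

/-- The skew inner product `⟨f, g⟩` of GinOE. -/
noncomputable def skewInner (f g : ℂ → ℂ) : ℂ :=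
  (∫ x : ℝ, ∫ y : ℝ, skewRealIntegrand f g x y) +
    2 * Complex.I * ∫ z in {z : ℂ | 0 < z.im}, skewComplexIntegrand f g z

/-- The integrals in `skewInner f g` converge absolutely. -/
def SkewIntegrable (f g : ℂ → ℂ) : Prop :=
  Integrable (fun q : ℝ × ℝ => skewRealIntegrand f g q.1 q.2) ∧
    IntegrableOn (skewComplexIntegrand f g) {z : ℂ | 0 < z.im}

/-- `p 0, p 1, …` are skew-orthogonal monic polynomials (`p j` of degree `j`) for the skew inner
product of GinOE, with skew norms `r 0, r 1, …`. -/
structure IsSkewOrthogonal (p : ℕ → ℂ → ℂ) (r : ℕ → ℝ) : Prop where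
  monic : ∀ j, ∃ q : Polynomial ℂ, q.Monic ∧ q.natDegree = j ∧ ∀ z, p j z = q.eval z
  integrable : ∀ j k, SkewIntegrable (p j) (p k)
  even_even : ∀ j k, skewInner (p (2 * j)) (p (2 * k)) = 0
  odd_odd : ∀ j k, skewInner (p (2 * j + 1)) (p (2 * k + 1)) = 0
  even_odd : ∀ j k, skewInner (p (2 * j)) (p (2 * k + 1)) = if j = k then (r j : ℂ) else 0
  odd_even : ∀ j k, skewInner (p (2 * k + 1)) (p (2 * j)) = if j = k then -(r j : ℂ) else 0

/-! ### Averaging over sign changes -/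

/-! Sign-symmetric part. The admissible sign changes generate a finite group acting row by row, and
averaging over its generators leaves all expectations unchanged. Under this average every single
entry has mean zero, different rows decouple, and squares of entries are untouched. A term of the
determinant contains one entry from each row, so only `z ^ N` survives in `⟨det(z - G)⟩`. In `⟨det(z
- G) Tr G⟩` the extra diagonal entry must meet itself, which leaves `-z ^ (N - 1) ⟨∑ G_jj²⟩`. To
pass from `∑ G_jj²` to `Tr G²`, write `Tr G² = (Tr G)² - 2 e₂(G)`. The means of `e₂` and `(Tr G)²`
are coefficients of averaged polynomials in `w`, so they exist and are determined by the known
values (`integral_coeff_of_integral_eval`, `SignSymmetric.averages`).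

Skew orthogonality. Put `q_b = z ^ (b + 1) - b z ^ (b - 1) = -e^{z²/2} (e^{-z²/2} z ^ b)'`. In the
real integral the sign kernel inverts the derivative, so `⟨z ^ a, q_b⟩` has real part integral `2 ∫
e^{-x²} x ^ (a + b)`. In the complex integral the weight is `e^{-(z² + conj z²)/2} erfc(√2 y)`.
Integration by parts (`ginMoment_re_relation`, `ginMoment_im_relation`) then gives a boundary term
on the real line, which cancels the real integral exactly, and a bulk term from the derivative of
`erfc`. The bulk weight is the rotation-invariant `e^{-|z|²}`, for which monomials are orthogonal
over the plane; this yields `skewInner_pow_sub`. Equal parities are handled by reflection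
(`skewInner_eq_zero_of_parity`). -/

theorem measurable_matrix_apply {m n α : Type*} [MeasurableSpace α] (i : m) (j : n) :
    Measurable fun A : Matrix m n α => A i j :=
  (measurable_pi_apply j).comp (measurable_pi_apply (X := fun _ : m => n → α) i)

theorem measurable_matrix_of_apply {m n α β : Type*} [MeasurableSpace α] [MeasurableSpace β]
    {f : β → Matrix m n α} (hf : ∀ i j, Measurable fun b => f b i j) : Measurable f :=
  measurable_pi_iff.2 fun i => measurable_pi_iff.2 fun j => hf i j

theorem measurable_matrix_trace {N : ℕ} :
    Measurable fun A : Matrix (Fin N) (Fin N) ℂ => A.trace :=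
  Finset.measurable_sum _ fun i _ => measurable_matrix_apply i i

theorem measurable_matrix_det {N : ℕ} :
    Measurable fun A : Matrix (Fin N) (Fin N) ℂ => A.det := by
  simp only [Matrix.det_apply']
  exact Finset.measurable_fun_sum _ fun σ _ =>
    (Finset.measurable_fun_prod _ fun i _ => measurable_matrix_apply (σ i) i).const_mul _

theorem measurable_charDet {N : ℕ} (z : ℂ) :
    Measurable (charDet z : Matrix (Fin N) (Fin N) ℂ → ℂ) :=
  measurable_matrix_det.comp <| measurable_matrix_of_apply fun i j =>
    (measurable_matrix_apply i j).const_sub ((z • (1 : Matrix (Fin N) (Fin N) ℂ)) i j)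

/-- Multiply the matrix `A` entrywise by `ε`. -/
def scaleEntries {N : ℕ} (ε : Fin N → Fin N → ℂ) (A : Matrix (Fin N) (Fin N) ℂ) :
    Matrix (Fin N) (Fin N) ℂ :=
  Matrix.of fun i l => ε i l * A i l

theorem measurable_scaleEntries {N : ℕ} (ε : Fin N → Fin N → ℂ) :
    Measurable (scaleEntries ε) :=
  measurable_matrix_of_apply fun i j => (measurable_matrix_apply i j).const_mul _

/-- The entrywise factors that leave the law of `G` unchanged. -/
def lawPreservingScalings {Ω : Type*} [MeasurableSpace Ω] {N : ℕ} (μ : Measure Ω)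
    (G : Ω → Matrix (Fin N) (Fin N) ℂ) (hG : AEMeasurable G μ) :
    Submonoid (Fin N → Fin N → ℂ) where
  carrier := {ε | IdentDistrib (fun ω => scaleEntries ε (G ω)) G μ μ}
  one_mem' := by
    have : (fun ω => scaleEntries 1 (G ω)) = G := by
      ext ω i j; simp [scaleEntries]
    simpa [this] using IdentDistrib.refl hG
  mul_mem' := by
    intro ε δ hε hδ
    have h := (IdentDistrib.comp hδ (measurable_scaleEntries ε)).trans hε
    have e : (fun ω => scaleEntries (ε * δ) (G ω)) =
        scaleEntries ε ∘ fun ω => scaleEntries δ (G ω) := by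
      ext ω i j; simp [scaleEntries, mul_assoc]
    simpa [e] using h

/-- The sign vector obtained by negating successively along the sets `s k`, `k ∈ V`. -/
noncomputable def flipSign {N : ℕ} (s : Fin N → Finset (Fin N)) (V : Finset (Fin N))
    (l : Fin N) : ℂ :=
  ∏ k ∈ V, if l ∈ s k then -1 else 1

/-- The sum over subsets factors as `∏ k, (1 ± 1)`, and the factor `k = l` vanishes because `l ∈ s
l`. The other members of the sets `s k` are irrelevant. -/
theorem sum_flipSign {N : ℕ} (s : Fin N → Finset (Fin N)) (hs : ∀ k, k ∈ s k) (l : Fin N) :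
    ∑ V, flipSign s V l = 0 := by
  have h := Finset.prod_one_add (f := fun k => if l ∈ s k then (-1 : ℂ) else 1)
    (Finset.univ : Finset (Fin N))
  rw [Finset.powerset_univ] at h
  unfold flipSign
  rw [← h]
  exact Finset.prod_eq_zero (Finset.mem_univ l) (by simp [hs])

theorem flipSign_mul_self {N : ℕ} (s : Fin N → Finset (Fin N)) (V : Finset (Fin N))
    (l : Fin N) : flipSign s V l * flipSign s V l = 1 := by
  unfold flipSign
  rw [← Finset.prod_mul_distrib]
  exact Finset.prod_eq_one fun k _ => by split_ifs <;> norm_num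

theorem negateInRow_eq_scaleEntries {N : ℕ} (j : Fin N) (s : Finset (Fin N))
    (A : Matrix (Fin N) (Fin N) ℂ) :
    negateInRow j s A =
      scaleEntries (fun i l => if i = j then (if l ∈ s then -1 else 1) else 1) A := by
  ext i l
  by_cases hi : i = j <;> by_cases hl : l ∈ s <;> simp [negateInRow, scaleEntries, hi, hl]

/-- Law-preserving scalings are closed under products, so flips in different rows can be combined
without any independence of the rows. -/
theorem identDistrib_flipSign {Ω : Type*} [MeasurableSpace Ω] {N : ℕ} {μ : Measure Ω}
    {G : Ω → Matrix (Fin N) (Fin N) ℂ} (hG : AEMeasurable G μ)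
    {s : Fin N → Fin N → Finset (Fin N)}
    (hs : ∀ j k, IdentDistrib (fun ω => negateInRow j (s j k) (G ω)) G μ μ)
    (U : Fin N → Finset (Fin N)) :
    IdentDistrib (fun ω => scaleEntries (fun i => flipSign (s i) (U i)) (G ω)) G μ μ := by
  have h : (∏ j, ∏ k ∈ U j, fun i l => if i = j then (if l ∈ s j k then (-1 : ℂ) else 1) else 1) ∈
      lawPreservingScalings μ G hG := by
    refine prod_mem fun j _ => prod_mem fun k _ => ?_
    have := hs j k
    simp only [negateInRow_eq_scaleEntries] at this
    exact this
  have e : (∏ j, ∏ k ∈ U j, fun i l => if i = j then (if l ∈ s j k then (-1 : ℂ) else 1) else 1) =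
      fun i => flipSign (s i) (U i) := by
    ext i l
    simp only [Finset.prod_apply]
    rw [Finset.prod_eq_single i]
    · simp [flipSign]
    · intro j _ hj
      simp [hj.symm]
    · simp
  rw [e] at h
  exact h

/-- A function of `G` and its average over all sign changes have the same mean. -/
theorem integral_signAverage {Ω : Type*} [MeasurableSpace Ω] {N : ℕ} {μ : Measure Ω}
    {G : Ω → Matrix (Fin N) (Fin N) ℂ} (hG : AEMeasurable G μ)
    {s : Fin N → Fin N → Finset (Fin N)}
    (hs : ∀ j k, IdentDistrib (fun ω => negateInRow j (s j k) (G ω)) G μ μ)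
    {F F' : Matrix (Fin N) (Fin N) ℂ → ℂ} (hF : Measurable F)
    (hFG : Integrable (fun ω => F (G ω)) μ)
    (h : ∀ A, ∑ U : Fin N → Finset (Fin N), F (scaleEntries (fun i => flipSign (s i) (U i)) A) =
      Fintype.card (Fin N → Finset (Fin N)) * F' A) :
    Integrable (fun ω => F' (G ω)) μ ∧ ∫ ω, F' (G ω) ∂μ = ∫ ω, F (G ω) ∂μ := by
  have hc : (Fintype.card (Fin N → Finset (Fin N)) : ℂ) ≠ 0 :=
    Nat.cast_ne_zero.2 Fintype.card_ne_zero
  have hF' : (fun ω => F' (G ω)) = fun ω => (Fintype.card (Fin N → Finset (Fin N)) : ℂ)⁻¹ *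
      ∑ U : Fin N → Finset (Fin N), F (scaleEntries (fun i => flipSign (s i) (U i)) (G ω)) := by
    ext ω; rw [h]; field_simp
  have hU := fun U => (identDistrib_flipSign hG hs U).comp hF
  have hi : ∀ U : Fin N → Finset (Fin N), Integrable (fun ω =>
      F (scaleEntries (fun i => flipSign (s i) (U i)) (G ω))) μ :=
    fun U => (hU U).integrable_iff.2 hFG
  rw [hF']
  refine ⟨(integrable_finsetSum _ fun U _ => hi U).const_mul _, ?_⟩
  rw [integral_const_mul, integral_finsetSum _ fun U _ => hi U]
  have : ∀ U : Fin N → Finset (Fin N), ∫ ω,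
      F (scaleEntries (fun i => flipSign (s i) (U i)) (G ω)) ∂μ = ∫ ω, F (G ω) ∂μ :=
    fun U => (hU U).integral_eq
  simp only [this, Finset.sum_const, Finset.card_univ, nsmul_eq_mul]
  field_simp

/-! ### Sign averages of the characteristic polynomial. -/

theorem charDet_eq_sum {N : ℕ} (z : ℂ) (A : Matrix (Fin N) (Fin N) ℂ) :
    charDet z A = ∑ σ : Equiv.Perm (Fin N), (Equiv.Perm.sign σ : ℂ) *
      ∏ i, ((if i = σ i then z else 0) - A i (σ i)) := by
  rw [charDet, ← Matrix.det_transpose, Matrix.det_apply']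
  simp [Matrix.one_apply]

theorem card_signChoices (N : ℕ) : (Fintype.card (Fin N → Finset (Fin N)) : ℂ) =
    ∏ _i : Fin N, (Fintype.card (Finset (Fin N)) : ℂ) := by
  simp

/-- For each permutation the sum over `U` factors over the rows, and in each row the signed entry
sums to zero. What remains is the same expression for the zero matrix. -/
theorem sum_charDet_flipSign {N : ℕ} {s : Fin N → Fin N → Finset (Fin N)}
    (hs : ∀ j k, k ∈ s j k) (z : ℂ) (A : Matrix (Fin N) (Fin N) ℂ) :
    ∑ U : Fin N → Finset (Fin N), charDet z (scaleEntries (fun i => flipSign (s i) (U i)) A) =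
      Fintype.card (Fin N → Finset (Fin N)) * z ^ N := by
  have h0 : (z ^ N : ℂ) = charDet z (0 : Matrix (Fin N) (Fin N) ℂ) := by
    simp [charDet]
  rw [h0]
  simp only [charDet_eq_sum]
  rw [Finset.sum_comm, Finset.mul_sum]
  refine Finset.sum_congr rfl fun σ _ => ?_
  rw [← Finset.mul_sum, mul_left_comm, card_signChoices, ← Finset.prod_mul_distrib]
  congr 1
  simp only [scaleEntries, Matrix.of_apply]
  rw [← Fintype.prod_sum (fun i V =>
    (if i = σ i then z else 0) - flipSign (s i) V (σ i) * A i (σ i))]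
  refine Finset.prod_congr rfl fun i _ => ?_
  rw [Finset.sum_sub_distrib, ← Finset.sum_mul, sum_flipSign _ (hs i)]
  simp

/-- Only the identity permutation contributes: there row `j` produces `-A j j ^ 2`, since signs
square to one, and each other row produces `z`. -/
theorem sum_charDet_mul_diag_flipSign {N : ℕ} {s : Fin N → Fin N → Finset (Fin N)}
    (hs : ∀ j k, k ∈ s j k) (z : ℂ) (A : Matrix (Fin N) (Fin N) ℂ) (j : Fin N) :
    ∑ U : Fin N → Finset (Fin N), charDet z (scaleEntries (fun i => flipSign (s i) (U i)) A) *
        (flipSign (s j) (U j) j * A j j) =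
      Fintype.card (Fin N → Finset (Fin N)) * (-z ^ (N - 1) * A j j ^ 2) := by
  simp only [charDet_eq_sum, Finset.sum_mul]
  rw [Finset.sum_comm, Finset.sum_eq_single 1]
  -- The extra factor is a row `j` quantity; absorbing it into the product over rows lets the sum
  -- over `U` factor again.
  · have e : ∀ U : Fin N → Finset (Fin N),
        (∏ i, ((if i = (1 : Equiv.Perm (Fin N)) i then z else 0) -
          scaleEntries (fun i => flipSign (s i) (U i)) A i ((1 : Equiv.Perm (Fin N)) i))) *
          (flipSign (s j) (U j) j * A j j) =
        ∏ i, ((z - flipSign (s i) (U i) i * A i i) *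
          if i = j then flipSign (s i) (U i) i * A i i else 1) := by
      intro U
      rw [Finset.prod_mul_distrib, Finset.prod_ite_eq' Finset.univ j]
      simp [scaleEntries]
    simp only [e, Equiv.Perm.sign_one, Units.val_one, Int.cast_one, one_mul]
    rw [← Fintype.prod_sum (fun i V => (z - flipSign (s i) V i * A i i) *
          if i = j then flipSign (s i) V i * A i i else 1),
      Fintype.prod_eq_mul_prod_compl j, card_signChoices, Fintype.prod_eq_mul_prod_compl j]
    have h1 : ∑ V, (z - flipSign (s j) V j * A j j) *
        (if j = j then flipSign (s j) V j * A j j else 1) =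
        Fintype.card (Finset (Fin N)) * -A j j ^ 2 := by
      have : ∀ V, (z - flipSign (s j) V j * A j j) *
        (if j = j then flipSign (s j) V j * A j j else 1) =
          flipSign (s j) V j * (z * A j j) - A j j ^ 2 := by
        intro V
        rw [if_pos rfl]
        linear_combination (-A j j ^ 2) * flipSign_mul_self (s j) V j
      rw [Finset.sum_congr rfl fun V _ => this V]
      rw [Finset.sum_sub_distrib, ← Finset.sum_mul, sum_flipSign _ (hs j)]
      simp
    have h2 : ∀ i ∈ ({j}ᶜ : Finset (Fin N)), ∑ V, (z - flipSign (s i) V i * A i i) *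
        (if i = j then flipSign (s i) V i * A i i else 1) =
        Fintype.card (Finset (Fin N)) * z := by
      intro i hi
      simp only [Finset.mem_compl, Finset.mem_singleton] at hi
      simp only [hi, if_false, mul_one]
      rw [Finset.sum_sub_distrib, ← Finset.sum_mul, sum_flipSign _ (hs i)]
      simp
    rw [h1, Finset.prod_congr rfl h2, Finset.prod_mul_distrib]
    simp only [Finset.prod_const, Finset.card_compl, Finset.card_singleton, Fintype.card_fin]
    ring
  · intro σ _ hσ
    -- A nontrivial permutation moves at least two indices, hence one other than `j`. Row `i` then
    -- contains a single signed entry and sums to zero.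
    obtain ⟨i, hij, hi⟩ : ∃ i, i ≠ j ∧ σ i ≠ i := by
      by_contra! h
      refine hσ (Equiv.ext fun i => ?_)
      by_cases hij : i = j
      · subst hij
        by_contra hne
        exact hne (σ.injective (h _ hne))
      · exact h i hij
    have e : ∀ U : Fin N → Finset (Fin N),
        (∏ i, ((if i = σ i then z else 0) -
          scaleEntries (fun i => flipSign (s i) (U i)) A i (σ i))) *
          (flipSign (s j) (U j) j * A j j) =
        ∏ i, (((if i = σ i then z else 0) - flipSign (s i) (U i) (σ i) * A i (σ i)) *
          if i = j then flipSign (s i) (U i) i * A i i else 1) := by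
      intro U
      rw [Finset.prod_mul_distrib, Finset.prod_ite_eq' Finset.univ j]
      simp [scaleEntries]
    simp only [mul_assoc, e]
    rw [← Finset.mul_sum, ← Fintype.prod_sum (fun i V =>
      ((if i = σ i then z else 0) - flipSign (s i) V (σ i) * A i (σ i)) *
          if i = j then flipSign (s i) V i * A i i else 1),
      Finset.prod_eq_zero (Finset.mem_univ i), mul_zero]
    simp only [hij, hi.symm, if_false, mul_one, zero_sub]
    rw [Finset.sum_neg_distrib, ← Finset.sum_mul, sum_flipSign _ (hs i)]
    simp
  · simp

theorem sum_charDet_mul_trace_flipSign {N : ℕ} {s : Fin N → Fin N → Finset (Fin N)}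
    (hs : ∀ j k, k ∈ s j k) (z : ℂ) (A : Matrix (Fin N) (Fin N) ℂ) :
    ∑ U : Fin N → Finset (Fin N), charDet z (scaleEntries (fun i => flipSign (s i) (U i)) A) *
        (scaleEntries (fun i => flipSign (s i) (U i)) A).trace =
      Fintype.card (Fin N → Finset (Fin N)) * (-z ^ (N - 1) * ∑ j, A j j ^ 2) := by
  simp only [Matrix.trace, Finset.mul_sum]
  rw [Finset.sum_comm]
  refine Finset.sum_congr rfl fun j _ => ?_
  exact sum_charDet_mul_diag_flipSign hs z A j

theorem SignSymmetric.aemeasurable {Ω : Type*} [MeasurableSpace Ω] {N : ℕ} {μ : Measure Ω}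
    {G : Ω → Matrix (Fin N) (Fin N) ℂ} (h : SignSymmetric μ G) : AEMeasurable G μ := by
  -- For `N = 0` sign symmetry is vacuous, and measurability holds because there are no entries.
  rcases isEmpty_or_nonempty (Fin N) with h0 | ⟨⟨j⟩⟩
  · exact (measurable_matrix_of_apply fun i => h0.elim i).aemeasurable
  · obtain ⟨s, -, hs⟩ := h j j
    exact hs.aemeasurable_snd

/-! ### Coefficients of random polynomials -/

/-- By Lagrange interpolation, a coefficient is a fixed finite linear combination of values at `D`
nodes. The nodes `1, …, D` avoid `0`, where nothing is assumed. -/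
theorem integral_coeff_of_integral_eval {Ω : Type*} [MeasurableSpace Ω] {μ : Measure Ω}
    {P : Ω → Polynomial ℂ} {Q : Polynomial ℂ} {D : ℕ} (hP : ∀ ω, (P ω).natDegree < D)
    (hQ : Q.natDegree < D)
    (hint : ∀ w : ℂ, w ≠ 0 → Integrable (fun ω => (P ω).eval w) μ)
    (hval : ∀ w : ℂ, w ≠ 0 → ∫ ω, (P ω).eval w ∂μ = Q.eval w) (k : ℕ) :
    Integrable (fun ω => (P ω).coeff k) μ ∧ ∫ ω, (P ω).coeff k ∂μ = Q.coeff k := by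
  have hinj : Set.InjOn (fun i : ℕ => (i : ℂ) + 1) (Finset.range D) := by
    intro i _ j _ hij
    exact_mod_cast add_right_cancel hij
  have key : ∀ R : Polynomial ℂ, R.natDegree < D → R.coeff k =
      ∑ i ∈ Finset.range D, R.eval ((i : ℂ) + 1) *
        (Lagrange.basis (Finset.range D) (fun i : ℕ => (i : ℂ) + 1) i).coeff k := by
    intro R hR
    have hdeg : R.degree < (Finset.range D).card := by
      rw [Finset.card_range]
      exact lt_of_le_of_lt Polynomial.degree_le_natDegree (by exact_mod_cast hR)
    conv_lhs => rw [Lagrange.eq_interpolate hinj hdeg, Lagrange.interpolate_apply]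
    simp
  have hne : ∀ i : ℕ, (i : ℂ) + 1 ≠ 0 := fun i => by exact_mod_cast i.succ_ne_zero
  simp only [key _ (hP _), key Q hQ]
  have hi : ∀ i ∈ Finset.range D, Integrable (fun ω => (P ω).eval ((i : ℂ) + 1) *
        (Lagrange.basis (Finset.range D) (fun i : ℕ => (i : ℂ) + 1) i).coeff k) μ :=
    fun i _ => (hint _ (hne i)).mul_const _
  refine ⟨integrable_finsetSum _ hi, ?_⟩
  rw [integral_finsetSum _ hi]
  simp only [integral_mul_const, hval _ (hne _)]

theorem eval_charpolyRev_eq_det {N : ℕ} (A : Matrix (Fin N) (Fin N) ℂ) (w : ℂ) :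
    A.charpolyRev.eval w = (1 - w • A).det := by
  rw [Matrix.charpolyRev, ← Polynomial.coe_evalRingHom, RingHom.map_det]
  congr 1
  ext i j
  by_cases h : i = j <;> simp [h, mul_comm w]

/-- The reversed polynomial is convenient because `1`, `-Tr A`, `e₂(A)` are its coefficients of
degree `0, 1, 2` for every `N`. -/
theorem eval_charpolyRev_eq_charDet {N : ℕ} (A : Matrix (Fin N) (Fin N) ℂ) {w : ℂ}
    (hw : w ≠ 0) : A.charpolyRev.eval w = w ^ N * charDet w⁻¹ A := by
  have h := Matrix.det_smul (w⁻¹ • (1 : Matrix (Fin N) (Fin N) ℂ) - A) w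
  rw [Fintype.card_fin] at h
  rw [eval_charpolyRev_eq_det, charDet, ← h, smul_sub, smul_smul, mul_inv_cancel₀ hw, one_smul]

theorem natDegree_charpolyRev_le {N : ℕ} (A : Matrix (Fin N) (Fin N) ℂ) :
    A.charpolyRev.natDegree ≤ N := by
  rw [← Matrix.reverse_charpoly]
  refine (Polynomial.reverse_natDegree_le _).trans ?_
  rw [Matrix.charpoly_natDegree_eq_dim, Fintype.card_fin]

/-- Compare the coefficients of `w²` in `det(1 - w² A²) = det(1 - w A) det(1 + w A)`. -/
theorem trace_sq_eq_coeff_charpolyRev {N : ℕ} (A : Matrix (Fin N) (Fin N) ℂ) :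
    (A ^ 2).trace = A.trace ^ 2 - 2 * A.charpolyRev.coeff 2 := by
  have h : (A ^ 2).charpolyRev.comp (Polynomial.X ^ 2) =
      A.charpolyRev * A.charpolyRev.comp (-Polynomial.X) := by
    refine Polynomial.funext fun w => ?_
    simp only [Polynomial.eval_comp, Polynomial.eval_mul, Polynomial.eval_pow, Polynomial.eval_X,
      Polynomial.eval_neg, eval_charpolyRev_eq_det]
    rw [← Matrix.det_mul]
    congr 1
    simp only [sub_mul, one_mul, mul_one, neg_smul, sub_neg_eq_add, mul_add, smul_mul_smul,
      pow_two]
    abel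
  have h2 := congrArg (fun p => Polynomial.coeff p 2) h
  have e1 : ((A ^ 2).charpolyRev.comp (Polynomial.X ^ 2)).coeff 2 =
      (A ^ 2).charpolyRev.coeff 1 := by
    rw [← Polynomial.expand_eq_comp_X_pow]
    exact Polynomial.coeff_expand_mul (p := 2) (by norm_num) (A ^ 2).charpolyRev 1
  have e2 : ∀ k, (A.charpolyRev.comp (-Polynomial.X)).coeff k =
      (-1) ^ k * A.charpolyRev.coeff k := fun k => by
    rw [← neg_one_mul, ← Polynomial.C_1, ← Polynomial.C_neg, Polynomial.comp_C_mul_X_coeff, mul_comm]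
  have e0 : A.charpolyRev.coeff 0 = 1 := by
    rw [Polynomial.coeff_zero_eq_eval_zero, Matrix.eval_charpolyRev]
  simp only [e1, Polynomial.coeff_mul, Finset.Nat.antidiagonal_succ, e2,
    Matrix.coeff_charpolyRev_eq_neg_trace] at h2
  simp [e0] at h2
  linear_combination -h2

/-- The averages of the characteristic polynomial of a sign-symmetric random matrix. -/
theorem SignSymmetric.averages {Ω : Type*} [MeasurableSpace Ω] {N : ℕ} {μ : Measure Ω}
    [IsProbabilityMeasure μ] {G : Ω → Matrix (Fin N) (Fin N) ℂ} (h : SignSymmetric μ G)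
    (hG : AveragesExist μ G) :
    Integrable (fun ω => (G ω ^ 2).trace) μ ∧
      ∫ ω, (G ω ^ 2).trace ∂μ = ∫ ω, ∑ j, G ω j j ^ 2 ∂μ ∧
      ∀ z : ℂ, evenAverage μ G z = z ^ N ∧
        ∫ ω, charDet z (G ω) * (G ω).trace ∂μ = -(∫ ω, (G ω ^ 2).trace ∂μ) * z ^ (N - 1) := by
  have hm := h.aemeasurable
  choose s hs hid using h
  have even : ∀ z : ℂ, evenAverage μ G z = z ^ N := fun z => by
    have := (integral_signAverage (F' := fun _ => z ^ N) hm hid (measurable_charDet z) (hG z).1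
      (sum_charDet_flipSign hs z)).2
    simpa [evenAverage] using this.symm
  have odd : ∀ z : ℂ, ∫ ω, charDet z (G ω) * (G ω).trace ∂μ =
      -(∫ ω, ∑ j, G ω j j ^ 2 ∂μ) * z ^ (N - 1) := fun z => by
    have := (integral_signAverage (F' := fun A => -z ^ (N - 1) * ∑ j, A j j ^ 2) hm hid
      ((measurable_charDet z).mul measurable_matrix_trace) (hG z).2
      (sum_charDet_mul_trace_flipSign hs z)).2
    simp only [integral_const_mul] at this
    simp only [Pi.mul_apply] at this
    rw [← this]
    ring
  -- Since `w ^ N ⟨det(w⁻¹ - G)⟩ = 1`, the mean of `e₂(G)` is zero.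
  have c2 := integral_coeff_of_integral_eval (μ := μ) (P := fun ω => (G ω).charpolyRev)
    (Q := 1) (D := N + 1) (fun ω => Nat.lt_succ_of_le (natDegree_charpolyRev_le _)) (by simp)
    (fun w hw => by
      simp only [eval_charpolyRev_eq_charDet _ hw]
      exact (hG w⁻¹).1.const_mul _)
    (fun w hw => by
      have := even w⁻¹
      rw [evenAverage] at this
      simp only [eval_charpolyRev_eq_charDet _ hw]
      rw [integral_const_mul, this, ← mul_pow, mul_inv_cancel₀ hw]
      simp) 2
  -- The coefficient of `w` in `det(1 - w G) Tr G` is `-(Tr G)²`, and the mean of this polynomial is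
  -- `-⟨∑ G_jj²⟩ w`.
  have c1 := integral_coeff_of_integral_eval (μ := μ)
    (P := fun ω => (G ω).charpolyRev * Polynomial.C (G ω).trace)
    (Q := Polynomial.C (-∫ ω, ∑ j, G ω j j ^ 2 ∂μ) * Polynomial.X) (D := N + 2)
    (fun ω => by
      have := (Polynomial.natDegree_mul_C_le (G ω).charpolyRev (G ω).trace).trans
        (natDegree_charpolyRev_le _)
      omega)
    ((Polynomial.natDegree_C_mul_le _ _).trans_lt (by simp))
    (fun w hw => by
      simp only [Polynomial.eval_mul, Polynomial.eval_C, eval_charpolyRev_eq_charDet _ hw,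
        mul_assoc]
      exact (hG w⁻¹).2.const_mul _)
    (fun w hw => by
      simp only [Polynomial.eval_mul, Polynomial.eval_C, eval_charpolyRev_eq_charDet _ hw,
        mul_assoc]
      rw [integral_const_mul, odd]
      -- For `N = 0` the exponent `N - 1` truncates to `0`, but the diagonal sum is empty.
      rcases N with - | N
      · simp
      · simp only [Polynomial.eval_X, Nat.add_sub_cancel, inv_pow]
        field_simp
        simp [pow_succ, mul_assoc, mul_comm]) 1
  simp only [Polynomial.coeff_mul_C, Matrix.coeff_charpolyRev_eq_neg_trace,
    Polynomial.coeff_C_mul, Polynomial.coeff_X_one, mul_one] at c1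
  simp only [Polynomial.coeff_one] at c2
  have ht : (fun ω => (G ω ^ 2).trace) = fun ω =>
      -(-(G ω).trace * (G ω).trace) - 2 * (G ω).charpolyRev.coeff 2 := by
    ext ω; rw [trace_sq_eq_coeff_charpolyRev]; ring
  have hI : ∫ ω, (G ω ^ 2).trace ∂μ = ∫ ω, ∑ j, G ω j j ^ 2 ∂μ := by
    rw [ht, integral_sub c1.1.fun_neg (c2.1.const_mul _), integral_neg, c1.2, integral_const_mul, c2.2]
    simp
  refine ⟨?_, hI, fun z => ⟨even z, by rw [odd, hI]⟩⟩
  rw [ht]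
  exact c1.1.fun_neg.sub (c2.1.const_mul _)

/-! ### GinOE matrices -/

instance isProbabilityMeasure_ginOE (N : ℕ) : IsProbabilityMeasure (ginOE N) :=
  inferInstanceAs (IsProbabilityMeasure
    (Measure.pi fun _ : Fin N => Measure.pi fun _ : Fin N => gaussianReal 0 1))

theorem measurePreserving_ginOE_apply {N : ℕ} (i j : Fin N) :
    MeasurePreserving (fun A : Matrix (Fin N) (Fin N) ℝ => A i j) (ginOE N) (gaussianReal 0 1) :=
  (measurePreserving_eval (fun _ : Fin N => gaussianReal 0 1) j).comp
    (measurePreserving_eval (fun _ : Fin N => Measure.pi fun _ : Fin N => gaussianReal 0 1) i)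

theorem measurable_toComplexMatrix {N : ℕ} :
    Measurable (toComplexMatrix : Matrix (Fin N) (Fin N) ℝ → _) :=
  measurable_matrix_of_apply fun i j =>
    Complex.measurable_ofReal.comp (measurable_matrix_apply i j)

theorem measurePreserving_neg_gaussianReal :
    MeasurePreserving (fun x : ℝ => -x) (gaussianReal 0 1) (gaussianReal 0 1) :=
  ⟨measurable_neg, by simpa using gaussianReal_map_neg (μ := 0) (v := 1)⟩

theorem signSymmetric_ginOE (N : ℕ) :
    SignSymmetric (ginOE N) (toComplexMatrix : Matrix (Fin N) (Fin N) ℝ → _) := by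
  intro j k
  refine ⟨{k}, Finset.mem_singleton_self k, ?_⟩
  let T : Matrix (Fin N) (Fin N) ℝ → Matrix (Fin N) (Fin N) ℝ := fun A =>
    Matrix.of fun i l => (if i = j ∧ l = k then fun x : ℝ => -x else id) (A i l)
  have hT : MeasurePreserving T (ginOE N) (ginOE N) :=
    measurePreserving_pi (fun _ : Fin N => Measure.pi fun _ : Fin N => gaussianReal 0 1)
      (fun _ : Fin N => Measure.pi fun _ : Fin N => gaussianReal 0 1)
      (f := fun i (a : Fin N → ℝ) l => (if i = j ∧ l = k then fun x : ℝ => -x else id) (a l))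
      fun i => measurePreserving_pi (fun _ : Fin N => gaussianReal 0 1)
        (fun _ : Fin N => gaussianReal 0 1)
        (f := fun l => if i = j ∧ l = k then fun x : ℝ => -x else id) fun l => by
        split_ifs
        · exact measurePreserving_neg_gaussianReal
        · exact MeasurePreserving.id _
  have e : (fun A : Matrix (Fin N) (Fin N) ℝ => negateInRow j {k} (toComplexMatrix A)) =
      toComplexMatrix ∘ T := by
    ext A i l
    by_cases h : i = j ∧ l = k <;> simp [negateInRow, toComplexMatrix, T, h]
  rw [e]
  refine ⟨(measurable_toComplexMatrix.comp hT.measurable).aemeasurable,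
    measurable_toComplexMatrix.aemeasurable, ?_⟩
  rw [← Measure.map_map measurable_toComplexMatrix hT.measurable, hT.map_eq]

/-- `f` has finite absolute moments of every order. -/
def HasAllMoments {Ω : Type*} [MeasurableSpace Ω] (f : Ω → ℂ) (μ : Measure Ω) : Prop :=
  ∀ p : NNReal, MemLp f p μ

namespace HasAllMoments

variable {Ω ι : Type*} [MeasurableSpace Ω] {μ : Measure Ω} {f g : Ω → ℂ}

/-- Hölder with exponents `2p`, `2p`. Mere integrability would not be stable under products. -/
theorem mul (hf : HasAllMoments f μ) (hg : HasAllMoments g μ) :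
    HasAllMoments (fun ω => f ω * g ω) μ := fun p => by
  have : ENNReal.HolderTriple ((2 * p : NNReal) : ENNReal) ((2 * p : NNReal) : ENNReal) p := by
    constructor
    rcases eq_or_ne p 0 with rfl | hp
    · simp
    · rw [← ENNReal.coe_inv (by positivity), ← ENNReal.coe_inv hp, ← ENNReal.coe_add]
      congr 1
      field_simp
      norm_num
  exact MemLp.mul' (hg (2 * p)) (hf (2 * p))

theorem sum {s : Finset ι} {F : ι → Ω → ℂ} (h : ∀ i ∈ s, HasAllMoments (F i) μ) :
    HasAllMoments (fun ω => ∑ i ∈ s, F i ω) μ := fun p =>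
  memLp_finsetSum s fun i hi => h i hi p

theorem const [IsFiniteMeasure μ] (c : ℂ) : HasAllMoments (fun _ : Ω => c) μ :=
  fun _ => memLp_const c

theorem sub (hf : HasAllMoments f μ) (hg : HasAllMoments g μ) :
    HasAllMoments (fun ω => f ω - g ω) μ := fun p => (hf p).sub (hg p)

theorem prod [IsFiniteMeasure μ] {s : Finset ι} {F : ι → Ω → ℂ}
    (h : ∀ i ∈ s, HasAllMoments (F i) μ) : HasAllMoments (fun ω => ∏ i ∈ s, F i ω) μ := by
  classical
  induction s using Finset.induction_on with
  | empty => simpa using const 1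
  | insert a s ha ih =>
    simp only [Finset.prod_insert ha]
    exact (h a (Finset.mem_insert_self a s)).mul
      (ih fun i hi => h i (Finset.mem_insert_of_mem hi))

theorem integrable (hf : HasAllMoments f μ) : Integrable f μ :=
  memLp_one_iff_integrable.1 (by simpa using hf 1)

end HasAllMoments

theorem hasAllMoments_ginOE_apply {N : ℕ} (i j : Fin N) :
    HasAllMoments (fun A : Matrix (Fin N) (Fin N) ℝ => toComplexMatrix A i j) (ginOE N) :=
  fun p => ((memLp_id_gaussianReal p).comp_measurePreserving
    (measurePreserving_ginOE_apply i j)).ofReal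

theorem averagesExist_ginOE (N : ℕ) :
    AveragesExist (ginOE N) (toComplexMatrix : Matrix (Fin N) (Fin N) ℝ → _) := by
  intro z
  have hdet : HasAllMoments (fun A : Matrix (Fin N) (Fin N) ℝ => charDet z (toComplexMatrix A))
      (ginOE N) := by
    simp only [charDet_eq_sum]
    exact .sum fun σ _ => (HasAllMoments.const _).mul
      (.prod fun i _ => (HasAllMoments.const _).sub (hasAllMoments_ginOE_apply i (σ i)))
  exact ⟨hdet.integrable,
    (hdet.mul (.sum fun i _ => hasAllMoments_ginOE_apply i i)).integrable⟩

theorem integral_sum_diag_sq_ginOE (N : ℕ) :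
    ∫ A, ∑ j, toComplexMatrix A j j ^ 2 ∂(ginOE N) = N := by
  have hi : ∀ j : Fin N, ∫ A : Matrix (Fin N) (Fin N) ℝ, toComplexMatrix A j j ^ 2 ∂(ginOE N) = 1 := by
    intro j
    have h1 : ∫ x, x ^ 2 ∂(gaussianReal 0 1) = 1 := by
      have := variance_id_gaussianReal (μ := 0) (v := 1)
      rw [variance_eq_integral aemeasurable_id] at this
      simpa [integral_id_gaussianReal] using this
    have hp := measurePreserving_ginOE_apply (N := N) j j
    have h2 : ∫ A : Matrix (Fin N) (Fin N) ℝ, A j j ^ 2 ∂(ginOE N) = 1 := by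
      rw [← h1, ← hp.map_eq, integral_map hp.aemeasurable (by fun_prop)]
    have h3 : ∀ A : Matrix (Fin N) (Fin N) ℝ,
        toComplexMatrix A j j ^ 2 = ((A j j ^ 2 : ℝ) : ℂ) := fun A => by simp [toComplexMatrix]
    simp only [h3]
    rw [integral_complex_ofReal, h2, Complex.ofReal_one]
  rw [integral_finsetSum]
  · simp [hi]
  · intro j _
    simp only [pow_two]
    exact ((hasAllMoments_ginOE_apply j j).mul (hasAllMoments_ginOE_apply j j)).integrable

theorem trace_toComplexMatrix_sq {N : ℕ} (A : Matrix (Fin N) (Fin N) ℝ) :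
    (toComplexMatrix A ^ 2).trace = ((A ^ 2).trace : ℝ) := by
  simp [toComplexMatrix, Matrix.trace, pow_two, Matrix.mul_apply]

theorem integral_trace_sq_ginOE (N : ℕ) :
    ∫ A, (toComplexMatrix A ^ 2).trace ∂(ginOE N) = N :=
  ((signSymmetric_ginOE N).averages (averagesExist_ginOE N)).2.1.trans
    (integral_sum_diag_sq_ginOE N)

theorem ginOEPoly_even (n : ℕ) (z : ℂ) : ginOEPoly (2 * n) z = z ^ (2 * n) := by
  have h := (((signSymmetric_ginOE (2 * n)).averages (averagesExist_ginOE _)).2.2 z).1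
  have e : 2 * n / 2 = n := by omega
  rw [ginOEPoly, if_pos (even_two_mul n), e]
  exact h

/-- At `n = 0` the truncated exponent is harmless because its coefficient vanishes. -/
theorem ginOEPoly_odd (n : ℕ) (z : ℂ) :
    ginOEPoly (2 * n + 1) z = z ^ (2 * n + 1) - 2 * n * z ^ (2 * n - 1) := by
  have h := ((signSymmetric_ginOE (2 * n)).averages (averagesExist_ginOE _)).2.2 z
  have e : (2 * n + 1) / 2 = n := by omega
  rw [ginOEPoly, if_neg (by simp), e, oddAverage, h.1, h.2, integral_trace_sq_ginOE]
  push_cast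
  ring

theorem ginOEPoly_odd_eq_deriv (n : ℕ) (z : ℂ) :
    ginOEPoly (2 * n + 1) z = -Complex.exp (z ^ 2 / 2) *
      deriv (fun w : ℂ => Complex.exp (-w ^ 2 / 2) * ginOEPoly (2 * n) w) z := by
  simp only [ginOEPoly_even]
  have h1 : HasDerivAt (fun w : ℂ => Complex.exp (-w ^ 2 / 2)) (Complex.exp (-z ^ 2 / 2) * -z) z := by
    have := (((hasDerivAt_pow 2 z).neg).div_const 2).cexp
    exact this.congr_deriv (by simp; ring)
  have h2 := h1.mul (hasDerivAt_pow (2 * n) z)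
  have h3 : Complex.exp (z ^ 2 / 2) * Complex.exp (-z ^ 2 / 2) = 1 := by
    rw [← Complex.exp_add]; simp [neg_div]
  have h4 : deriv (fun w : ℂ => Complex.exp (-w ^ 2 / 2) * w ^ (2 * n)) z = _ := h2.deriv
  rw [h4, ginOEPoly_odd]
  push_cast
  linear_combination (-(z ^ (2 * n) * z) + 2 * n * z ^ (2 * n - 1)) * h3

/-! ### The weight -/

theorem integrable_exp_neg_sq : Integrable fun s : ℝ => Real.exp (-s ^ 2) := by
  simpa using integrable_exp_neg_mul_sq one_pos

theorem erfc_zero : erfc 0 = 1 := by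
  have h := integral_gaussian_Ioi 1
  simp only [neg_mul, one_mul, div_one] at h
  have : Real.sqrt Real.pi ≠ 0 := by positivity
  rw [erfc, h]
  field_simp

theorem erfc_nonneg (t : ℝ) : 0 ≤ erfc t :=
  mul_nonneg (by positivity) (integral_nonneg fun s => (Real.exp_pos _).le)

/-- For `s ≥ t ≥ 0` one has `s² ≥ t² + (s - t)²`; the shifted Gaussian is then integrated over the
whole line. The factor `e^{-t²}` exactly cancels `e^{2y²}` in `ginWeight_le`. -/
theorem erfc_le {t : ℝ} (ht : 0 ≤ t) : erfc t ≤ 2 * Real.exp (-t ^ 2) := by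
  have hi : Integrable fun s : ℝ => Real.exp (-t ^ 2) * Real.exp (-(s - t) ^ 2) :=
    (integrable_exp_neg_sq.comp_sub_right t).const_mul _
  have h1 : ∫ s in Set.Ioi t, Real.exp (-s ^ 2) ≤
      ∫ s in Set.Ioi t, Real.exp (-t ^ 2) * Real.exp (-(s - t) ^ 2) := by
    refine setIntegral_mono_on integrable_exp_neg_sq.integrableOn hi.integrableOn
      measurableSet_Ioi fun s hs => ?_
    rw [← Real.exp_add]
    have : 0 ≤ t * (s - t) := mul_nonneg ht (sub_nonneg.2 (le_of_lt hs))
    exact Real.exp_le_exp.2 (by nlinarith)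
  have h2 : ∫ s in Set.Ioi t, Real.exp (-t ^ 2) * Real.exp (-(s - t) ^ 2) ≤
      ∫ s, Real.exp (-t ^ 2) * Real.exp (-(s - t) ^ 2) :=
    setIntegral_le_integral hi (Filter.Eventually.of_forall fun s => by positivity)
  have h3 : ∫ s, Real.exp (-t ^ 2) * Real.exp (-(s - t) ^ 2) =
      Real.exp (-t ^ 2) * Real.sqrt Real.pi := by
    rw [integral_const_mul, integral_sub_right_eq_self (fun s => Real.exp (-s ^ 2)) t]
    have := integral_gaussian 1
    simp only [neg_mul, one_mul, div_one] at this
    rw [this]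
  have hp : 0 < Real.sqrt Real.pi := by positivity
  calc erfc t ≤ 2 / Real.sqrt Real.pi * (Real.exp (-t ^ 2) * Real.sqrt Real.pi) :=
        mul_le_mul_of_nonneg_left (h1.trans (h2.trans h3.le)) (by positivity)
    _ = 2 * Real.exp (-t ^ 2) := by field_simp

theorem hasDerivAt_erfc (t : ℝ) :
    HasDerivAt erfc (-(2 / Real.sqrt Real.pi * Real.exp (-t ^ 2))) t := by
  have hc : Continuous fun s : ℝ => Real.exp (-s ^ 2) := by fun_prop
  have h1 : erfc = fun u => 2 / Real.sqrt Real.pi *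
      ((∫ s in Set.Ioi 0, Real.exp (-s ^ 2)) - ∫ s in (0 : ℝ)..u, Real.exp (-s ^ 2)) := by
    ext u
    have := intervalIntegral.integral_interval_add_Ioi (a := 0) (b := u)
      integrable_exp_neg_sq.integrableOn integrable_exp_neg_sq.integrableOn
    rw [erfc, ← this]
    ring
  have h2 := ((intervalIntegral.integral_hasDerivAt_right (hc.intervalIntegrable 0 t)
    hc.stronglyMeasurable.stronglyMeasurableAtFilter hc.continuousAt).const_sub
      (∫ s in Set.Ioi 0, Real.exp (-s ^ 2))).const_mul (2 / Real.sqrt Real.pi)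
  rw [h1]
  exact h2.congr_deriv (by ring)

theorem continuous_erfc : Continuous erfc :=
  continuous_iff_continuousAt.2 fun t => (hasDerivAt_erfc t).continuousAt

theorem continuous_ginWeight : Continuous ginWeight := by
  have := continuous_erfc
  unfold ginWeight
  fun_prop

theorem ginWeight_nonneg (z : ℂ) : 0 ≤ ginWeight z :=
  mul_nonneg (by positivity) (erfc_nonneg _)

theorem ginWeight_le {z : ℂ} (hz : 0 < z.im) : ginWeight z ≤ 2 * Real.exp (-‖z‖ ^ 2) := by
  have h := erfc_le (t := Real.sqrt 2 * z.im) (by positivity)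
  have e : Real.exp (2 * z.im ^ 2) * Real.exp (-(Real.sqrt 2 * z.im) ^ 2) = 1 := by
    rw [← Real.exp_add, mul_pow, Real.sq_sqrt (by norm_num)]; simp
  calc ginWeight z ≤ Real.exp (-‖z‖ ^ 2) * Real.exp (2 * z.im ^ 2) *
        (2 * Real.exp (-(Real.sqrt 2 * z.im) ^ 2)) := mul_le_mul_of_nonneg_left h (by positivity)
    _ = 2 * Real.exp (-‖z‖ ^ 2) := by linear_combination 2 * Real.exp (-‖z‖ ^ 2) * e

theorem ginWeight_ofReal (x : ℝ) : ginWeight x = Real.exp (-x ^ 2) := by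
  simp [ginWeight, erfc_zero]

/-- As `-|z|² + 2y² = -Re z²`, the exponential splits into a function of `z` times the same function
of `conj z`, which is what integration by parts needs. -/
theorem ginWeight_eq_cexp (x y : ℝ) : (ginWeight (x + y * Complex.I) : ℂ) =
    Complex.exp (-((x + y * Complex.I) ^ 2 + (x - y * Complex.I) ^ 2) / 2) *
      erfc (Real.sqrt 2 * y) := by
  have h : ‖(x + y * Complex.I : ℂ)‖ ^ 2 = x ^ 2 + y ^ 2 := by
    rw [← Complex.normSq_eq_norm_sq, Complex.normSq_add_mul_I]
  have him : (x + y * Complex.I : ℂ).im = y := by simp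
  rw [ginWeight, h, him, ← Real.exp_add]
  push_cast
  congr 2
  linear_combination (y ^ 2 : ℂ) * Complex.I_sq

/-! ### Moments of the weight in the upper half plane -/

/-- The monomial `z ^ a * conj z ^ b`. -/
def conjMonomial (a b : ℕ) (z : ℂ) : ℂ := z ^ a * starRingEnd ℂ z ^ b

theorem continuous_conjMonomial (a b : ℕ) : Continuous (conjMonomial a b) := by
  have := Complex.continuous_conj
  unfold conjMonomial
  fun_prop

theorem norm_conjMonomial (a b : ℕ) (z : ℂ) : ‖conjMonomial a b z‖ = ‖z‖ ^ (a + b) := by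
  rw [conjMonomial, norm_mul, norm_pow, norm_pow, RCLike.norm_conj, pow_add]

theorem integral_norm_pow_mul_exp_neg_sq (m : ℕ) :
    ∫ z : ℂ, ‖z‖ ^ m * Real.exp (-‖z‖ ^ 2) = Real.pi * Real.Gamma ((m + 2) / 2) := by
  have h := Complex.integral_rpow_mul_exp_neg_rpow (p := 2) (q := m) (by norm_num)
    (by linarith [(Nat.cast_nonneg m : (0 : ℝ) ≤ m)])
  simpa [Real.rpow_natCast] using h

theorem integrable_norm_pow_mul_exp_neg_sq (m : ℕ) :
    Integrable fun z : ℂ => ‖z‖ ^ m * Real.exp (-‖z‖ ^ 2) := by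
  -- A non-integrable function would have integral `0` by convention, but the value is positive.
  by_contra h
  have h0 := integral_norm_pow_mul_exp_neg_sq m
  rw [integral_undef h] at h0
  have : 0 < Real.Gamma ((m + 2) / 2) := Real.Gamma_pos_of_pos (by positivity)
  exact (mul_pos Real.pi_pos this).ne h0

theorem integrable_gaussian_conjMonomial (a b : ℕ) :
    Integrable fun z : ℂ => (Real.exp (-‖z‖ ^ 2) : ℂ) * conjMonomial a b z := by
  refine (integrable_norm_pow_mul_exp_neg_sq (a + b)).mono' ?_ ?_
  · have := continuous_conjMonomial a b
    exact Continuous.aestronglyMeasurable (by fun_prop)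
  · refine Filter.Eventually.of_forall fun z => ?_
    rw [norm_mul, norm_conjMonomial, Complex.norm_real, Real.norm_of_nonneg (Real.exp_pos _).le,
      mul_comm]

theorem integrableOn_ginWeight_conjMonomial (a b : ℕ) :
    IntegrableOn (fun z : ℂ => (ginWeight z : ℂ) * conjMonomial a b z) {z | 0 < z.im} := by
  refine (((integrable_norm_pow_mul_exp_neg_sq (a + b)).const_mul 2).integrableOn).mono' ?_ ?_
  · have := continuous_conjMonomial a b
    have := continuous_ginWeight
    exact (Continuous.aestronglyMeasurable (by fun_prop))
  · refine ae_restrict_of_forall_mem (measurableSet_lt measurable_const Complex.measurable_im)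
      fun z hz => ?_
    rw [norm_mul, norm_conjMonomial, Complex.norm_real, Real.norm_of_nonneg (ginWeight_nonneg z)]
    calc ginWeight z * ‖z‖ ^ (a + b) ≤ 2 * Real.exp (-‖z‖ ^ 2) * ‖z‖ ^ (a + b) :=
          mul_le_mul_of_nonneg_right (ginWeight_le hz) (by positivity)
      _ = _ := by ring

/-! ### Integration by parts in the upper half plane. -/

theorem measurePreserving_upperHalfPlane :
    MeasurePreserving (fun q : ℝ × ℝ => (q.1 + q.2 * Complex.I : ℂ))
      ((volume : Measure ℝ).prod (volume.restrict (Set.Ioi 0)))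
      (volume.restrict {z : ℂ | 0 < z.im}) := by
  have h := (Complex.volume_preserving_equiv_real_prod.symm).restrict_preimage
    (s := {z : ℂ | 0 < z.im}) (measurableSet_lt measurable_const Complex.measurable_im)
  have e : (Complex.measurableEquivRealProd.symm : ℝ × ℝ → ℂ) =
      fun q : ℝ × ℝ => (q.1 + q.2 * Complex.I : ℂ) := by
    ext q
    rw [Complex.measurableEquivRealProd_symm_apply, Complex.mk_eq_add_mul_I]
  have e2 : (fun q : ℝ × ℝ => (q.1 + q.2 * Complex.I : ℂ)) ⁻¹' {z : ℂ | 0 < z.im} =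
      Set.univ ×ˢ Set.Ioi 0 := by
    ext q; simp
  rw [e, e2, Measure.volume_eq_prod, ← Measure.prod_restrict, Measure.restrict_univ] at h
  exact h

theorem measurableEmbedding_add_mul_I :
    MeasurableEmbedding (fun q : ℝ × ℝ => (q.1 + q.2 * Complex.I : ℂ)) := by
  have e : (Complex.measurableEquivRealProd.symm : ℝ × ℝ → ℂ) =
      fun q : ℝ × ℝ => (q.1 + q.2 * Complex.I : ℂ) := by
    ext q
    rw [Complex.measurableEquivRealProd_symm_apply, Complex.mk_eq_add_mul_I]
  rw [← e]
  exact MeasurableEquiv.measurableEmbedding _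

theorem integrable_add_mul_I {F : ℂ → ℂ} (hF : IntegrableOn F {z | 0 < z.im}) :
    Integrable (fun q : ℝ × ℝ => F (q.1 + q.2 * Complex.I))
      ((volume : Measure ℝ).prod (volume.restrict (Set.Ioi 0))) :=
  (measurePreserving_upperHalfPlane.integrable_comp_emb measurableEmbedding_add_mul_I).2 hF

theorem integral_upperHalfPlane (F : ℂ → ℂ) :
    ∫ z in {z : ℂ | 0 < z.im}, F z =
      ∫ q : ℝ × ℝ, F (q.1 + q.2 * Complex.I)
        ∂((volume : Measure ℝ).prod (volume.restrict (Set.Ioi 0))) :=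
  (measurePreserving_upperHalfPlane.integral_comp measurableEmbedding_add_mul_I F).symm

/-- An integral over the upper half plane of a horizontal derivative vanishes. -/
theorem integral_upperHalfPlane_deriv_re {F F' : ℂ → ℂ} (hF : IntegrableOn F {z | 0 < z.im})
    (hF' : IntegrableOn F' {z | 0 < z.im})
    (h : ∀ x y : ℝ, HasDerivAt (fun t : ℝ => F (t + y * Complex.I)) (F' (x + y * Complex.I)) x) :
    ∫ z in {z : ℂ | 0 < z.im}, F' z = 0 := by
  have i := integrable_add_mul_I hF
  have i' := integrable_add_mul_I hF'
  rw [integral_upperHalfPlane, integral_prod_symm _ i']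
  refine integral_eq_zero_of_ae ?_
  filter_upwards [i.prod_left_ae, i'.prod_left_ae] with y hy hy'
  exact integral_eq_zero_of_hasDerivAt_of_integrable (fun x => h x y) hy' hy

/-- An integral over the upper half plane of a vertical derivative is a boundary term. -/
theorem integral_upperHalfPlane_deriv_im {F F' : ℂ → ℂ} (hF : IntegrableOn F {z | 0 < z.im})
    (hF' : IntegrableOn F' {z | 0 < z.im})
    (h : ∀ x y : ℝ, HasDerivAt (fun t : ℝ => F (x + t * Complex.I)) (F' (x + y * Complex.I)) y) :
    ∫ z in {z : ℂ | 0 < z.im}, F' z = -∫ x : ℝ, F x := by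
  have i := integrable_add_mul_I hF
  have i' := integrable_add_mul_I hF'
  rw [integral_upperHalfPlane, integral_prod _ i', ← integral_neg]
  refine integral_congr_ae ?_
  filter_upwards [i.prod_right_ae, i'.prod_right_ae] with x hx hx'
  -- On almost every vertical line both the function and its derivative are integrable, so the
  -- function tends to zero at infinity.
  have ht := tendsto_zero_of_hasDerivAt_of_integrableOn_Ioi (fun y _ => h x y) hx' hx
  have := integral_Ioi_of_hasDerivAt_of_tendsto' (a := 0) (fun y _ => h x y) hx' ht
  simpa using this

/-- The moment `∫ ω z ^ a conj z ^ b` over the upper half plane. -/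
noncomputable def ginMoment (a b : ℕ) : ℂ :=
  ∫ z in {z : ℂ | 0 < z.im}, (ginWeight z : ℂ) * conjMonomial a b z

/-- One computation for both directions: `u`, `v` stand for `z`, `conj z` and `e` for the `erfc`
factor. Horizontally `u' = v' = 1`, `e' = 0`; vertically `u' = I`, `v' = -I`. -/
theorem HasDerivAt.cexp_mul_pow_mul_pow {u v e : ℝ → ℂ} {u' v' e' : ℂ} {t : ℝ}
    (hu : HasDerivAt u u' t) (hv : HasDerivAt v v' t) (he : HasDerivAt e e' t) (a b : ℕ) :
    HasDerivAt (fun s => Complex.exp (-(u s ^ 2 + v s ^ 2) / 2) * e s * (u s ^ a * v s ^ b))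
      (Complex.exp (-(u t ^ 2 + v t ^ 2) / 2) * (e t *
        (-u' * (u t ^ (a + 1) * v t ^ b) - v' * (u t ^ a * v t ^ (b + 1)) +
          u' * a * (u t ^ (a - 1) * v t ^ b) + v' * b * (u t ^ a * v t ^ (b - 1))) +
          e' * (u t ^ a * v t ^ b))) t := by
  have h := (((((hu.fun_pow 2).fun_add (hv.fun_pow 2)).fun_neg.div_const 2).cexp).fun_mul he).fun_mul
    ((hu.fun_pow a).fun_mul (hv.fun_pow b))
  refine h.congr_deriv ?_
  push_cast
  ring

theorem conj_add_mul_I (x y : ℝ) :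
    starRingEnd ℂ (x + y * Complex.I) = x - y * Complex.I := by
  simp [sub_eq_add_neg]

theorem ginWeight_mul_conjMonomial (a b : ℕ) (x y : ℝ) :
    (ginWeight (x + y * Complex.I) : ℂ) * conjMonomial a b (x + y * Complex.I) =
      Complex.exp (-((x + y * Complex.I) ^ 2 + (x - y * Complex.I) ^ 2) / 2) *
        (erfc (Real.sqrt 2 * y) : ℂ) * ((x + y * Complex.I) ^ a * (x - y * Complex.I) ^ b) := by
  rw [ginWeight_eq_cexp, conjMonomial, conj_add_mul_I]

theorem ginMoment_re_relation (a b : ℕ) :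
    ginMoment (a + 1) b - a * ginMoment (a - 1) b =
      -(ginMoment a (b + 1) - b * ginMoment a (b - 1)) := by
  have i := fun a b => integrableOn_ginWeight_conjMonomial a b
  have i1 := (i (a + 1) b).fun_neg
  have i2 := i1.sub (i a (b + 1))
  have i3 := (i (a - 1) b).const_mul (a : ℂ)
  have i4 := (i a (b - 1)).const_mul (b : ℂ)
  have key := integral_upperHalfPlane_deriv_re (i a b) ((i2.add i3).add i4) fun x y => by
    have hu : HasDerivAt (fun t : ℝ => (t + y * Complex.I : ℂ)) 1 x :=
      (hasDerivAt_id x).ofReal_comp.add_const _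
    have hv : HasDerivAt (fun t : ℝ => (t - y * Complex.I : ℂ)) 1 x :=
      (hasDerivAt_id x).ofReal_comp.sub_const _
    have h := hu.cexp_mul_pow_mul_pow hv
      (hasDerivAt_const x (erfc (Real.sqrt 2 * y) : ℂ)) a b
    simp only [Pi.add_apply, Pi.sub_apply, ginWeight_mul_conjMonomial]
    exact h.congr_deriv (by ring)
  rw [integral_add' (i2.add i3) i4, integral_add' i2 i3, integral_sub' i1 (i a (b + 1)),
    integral_neg, integral_const_mul, integral_const_mul] at key
  unfold ginMoment
  linear_combination -key

/-- Green's formula for the moments of the weight. -/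
theorem ginMoment_im_relation (a b : ℕ) :
    2 * Complex.I * (ginMoment a (b + 1) - b * ginMoment a (b - 1)) =
      (2 * Real.sqrt 2 / Real.sqrt Real.pi : ℝ) *
        (∫ z in {z : ℂ | 0 < z.im}, (Real.exp (-‖z‖ ^ 2) : ℂ) * conjMonomial a b z) -
      ∫ x : ℝ, (Real.exp (-x ^ 2) : ℂ) * x ^ (a + b) := by
  have i := fun a b => integrableOn_ginWeight_conjMonomial a b
  have i1 := (i (a + 1) b).const_mul (-Complex.I)
  have i2 := (i a (b + 1)).const_mul Complex.I
  have i3 := (i (a - 1) b).const_mul (Complex.I * a)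
  have i4 := (i a (b - 1)).const_mul (Complex.I * b)
  have i5 := ((integrable_gaussian_conjMonomial a b).integrableOn (s := {z : ℂ | 0 < z.im})).const_mul
    ((2 * Real.sqrt 2 / Real.sqrt Real.pi : ℝ) : ℂ)
  have key := integral_upperHalfPlane_deriv_im (i a b) ((((i1.add i2).add i3).sub i4).sub i5)
    fun x y => by
    have hu : HasDerivAt (fun t : ℝ => (x + t * Complex.I : ℂ)) Complex.I y := by
      simpa using ((hasDerivAt_id y).ofReal_comp.mul_const Complex.I).const_add (x : ℂ)
    have hv : HasDerivAt (fun t : ℝ => (x - t * Complex.I : ℂ)) (-Complex.I) y := by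
      simpa using ((hasDerivAt_id y).ofReal_comp.mul_const Complex.I).const_sub (x : ℂ)
    have he : HasDerivAt (fun t : ℝ => (erfc (Real.sqrt 2 * t) : ℂ))
        ((-(2 / Real.sqrt Real.pi * Real.exp (-(Real.sqrt 2 * y) ^ 2)) * Real.sqrt 2 : ℝ) : ℂ) y := by
      have := (hasDerivAt_erfc (Real.sqrt 2 * y)).comp y ((hasDerivAt_id y).const_mul (Real.sqrt 2))
      simpa using this.ofReal_comp
    have h := hu.cexp_mul_pow_mul_pow hv he a b
    have hexp : (Real.exp (-‖(x + y * Complex.I : ℂ)‖ ^ 2) : ℂ) =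
        Complex.exp (-((x + y * Complex.I) ^ 2 + (x - y * Complex.I) ^ 2) / 2) *
          Real.exp (-(Real.sqrt 2 * y) ^ 2) := by
      have h : ‖(x + y * Complex.I : ℂ)‖ ^ 2 = x ^ 2 + y ^ 2 := by
        rw [← Complex.normSq_eq_norm_sq, Complex.normSq_add_mul_I]
      rw [h, mul_pow, Real.sq_sqrt (by norm_num)]
      push_cast
      rw [← Complex.exp_add]
      congr 1
      linear_combination (y ^ 2 : ℂ) * Complex.I_sq
    simp only [Pi.add_apply, Pi.sub_apply, ginWeight_mul_conjMonomial, hexp]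
    refine h.congr_deriv ?_
    rw [conjMonomial, conj_add_mul_I]
    push_cast
    ring
  rw [integral_sub' (((i1.add i2).add i3).sub i4) i5, integral_sub' ((i1.add i2).add i3) i4,
    integral_add' (i1.add i2) i3, integral_add' i1 i2] at key
  simp only [integral_const_mul] at key
  have hb : ∀ x : ℝ, (ginWeight x : ℂ) * conjMonomial a b x =
      (Real.exp (-x ^ 2) : ℂ) * x ^ (a + b) := fun x => by
    rw [ginWeight_ofReal, conjMonomial, Complex.conj_ofReal, pow_add]
  simp only [hb] at key
  have hre := ginMoment_re_relation a b
  unfold ginMoment at hre ⊢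
  -- The horizontal relation trades the moments where `z` is differentiated for those where `conj z`
  -- is, which doubles the latter.
  linear_combination key + Complex.I * hre

/-! ### Gaussian moments in the plane -/

/-- Conjugation exchanges the half planes, and the real line is a null set. -/
theorem integral_conjMonomial_swap (a b : ℕ) :
    ∫ z in {z : ℂ | 0 < z.im}, (Real.exp (-‖z‖ ^ 2) : ℂ) * conjMonomial b a z =
      ∫ z in {z : ℂ | 0 < z.im}ᶜ, (Real.exp (-‖z‖ ^ 2) : ℂ) * conjMonomial a b z := by
  have hp : MeasurePreserving (fun z : ℂ => starRingEnd ℂ z) := Complex.conjLIE.measurePreserving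
  have he : MeasurableEmbedding (fun z : ℂ => starRingEnd ℂ z) :=
    Complex.conjLIE.toHomeomorph.measurableEmbedding
  have h := hp.setIntegral_preimage_emb he
    (fun z => (Real.exp (-‖z‖ ^ 2) : ℂ) * conjMonomial a b z) {z : ℂ | z.im < 0}
  have e : (fun z : ℂ => starRingEnd ℂ z) ⁻¹' {z : ℂ | z.im < 0} = {z : ℂ | 0 < z.im} := by
    ext z; simp
  rw [e] at h
  have hae : ({z : ℂ | 0 < z.im}ᶜ : Set ℂ) =ᵐ[volume] {z : ℂ | z.im < 0} := by
    have h0 : volume {z : ℂ | z.im = 0} = 0 := by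
      have := Measure.addHaar_submodule (volume : Measure ℂ) (LinearMap.ker Complex.imLm) (by
        intro h
        have : Complex.I ∈ LinearMap.ker Complex.imLm := by rw [h]; trivial
        simp at this)
      convert this using 2
      ext z; simp
    rw [ae_eq_set]
    constructor
    · refine measure_mono_null (fun z hz => ?_) h0
      simp only [Set.mem_sdiff, Set.mem_compl_iff, Set.mem_ofPred_eq, not_lt] at hz ⊢
      exact le_antisymm hz.1 hz.2
    · refine measure_mono_null (fun z hz => ?_) h0
      simp only [Set.mem_sdiff, Set.mem_compl_iff, Set.mem_ofPred_eq, not_not] at hz ⊢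
      exact absurd (hz.1.trans hz.2) (lt_irrefl _)
  rw [setIntegral_congr_set hae, ← h]
  refine integral_congr_ae (Filter.Eventually.of_forall fun z => ?_)
  simp only [conjMonomial, RCLike.norm_conj, Complex.conj_conj]
  ring

theorem integral_gaussian_conjMonomial (a b : ℕ) :
    ∫ z : ℂ, (Real.exp (-‖z‖ ^ 2) : ℂ) * conjMonomial a b z =
      if a = b then (Real.pi * Real.Gamma (a + 1) : ℝ) else 0 := by
  split_ifs with hab
  · subst hab
    have h := integral_norm_pow_mul_exp_neg_sq (2 * a)
    have e : ((2 * a : ℕ) + 2 : ℝ) / 2 = a + 1 := by push_cast; ring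
    rw [e] at h
    rw [← h, ← integral_complex_ofReal]
    refine integral_congr_ae (Filter.Eventually.of_forall fun z => ?_)
    simp only [conjMonomial, ← mul_pow, Complex.mul_conj, Complex.normSq_eq_norm_sq]
    push_cast
    ring
  -- Rotating by `c = e^{iθ}` multiplies the monomial by `e^{iθ(a - b)}`; the angle `θ = π / (a -
  -- b)` makes the integral equal to its own negative.
  · obtain ⟨c, hc⟩ : ∃ c : Circle, (c : ℂ) ^ a * starRingEnd ℂ (c : ℂ) ^ b = -1 := by
      have hd : ((a : ℂ) - b) ≠ 0 := sub_ne_zero.2 (by exact_mod_cast hab)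
      refine ⟨Circle.exp (Real.pi / ((a : ℝ) - b)), ?_⟩
      rw [← Circle.coe_inv_eq_conj, ← Circle.exp_neg, Circle.coe_exp, Circle.coe_exp,
        ← Complex.exp_nat_mul, ← Complex.exp_nat_mul, ← Complex.exp_add, ← Complex.exp_pi_mul_I]
      congr 1
      push_cast
      field_simp
      ring
    have h := ((rotation c).measurePreserving).integral_comp
      (rotation c).toHomeomorph.measurableEmbedding
      (fun z => (Real.exp (-‖z‖ ^ 2) : ℂ) * conjMonomial a b z)
    have e : ∀ z, (Real.exp (-‖rotation c z‖ ^ 2) : ℂ) * conjMonomial a b (rotation c z) =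
        -((Real.exp (-‖z‖ ^ 2) : ℂ) * conjMonomial a b z) := by
      intro z
      rw [LinearIsometryEquiv.norm_map, rotation_apply]
      simp only [conjMonomial, map_mul, mul_pow]
      linear_combination ((Real.exp (-‖z‖ ^ 2) : ℂ) * z ^ a * starRingEnd ℂ z ^ b) * hc
    simp only [e, integral_neg] at h
    exact self_eq_neg.1 h.symm

theorem integral_upperHalfPlane_add_swap (a b : ℕ) :
    (∫ z in {z : ℂ | 0 < z.im}, (Real.exp (-‖z‖ ^ 2) : ℂ) * conjMonomial a b z) +
      ∫ z in {z : ℂ | 0 < z.im}, (Real.exp (-‖z‖ ^ 2) : ℂ) * conjMonomial b a z =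
      if a = b then (Real.pi * Real.Gamma (a + 1) : ℝ) else 0 := by
  rw [integral_conjMonomial_swap a b, ← integral_gaussian_conjMonomial]
  exact integral_add_compl (measurableSet_lt measurable_const Complex.measurable_im)
    (integrable_gaussian_conjMonomial a b)

/-! ### The skew inner product -/

theorem measurable_realSign : Measurable Real.sign :=
  Measurable.ite (measurableSet_lt measurable_id measurable_const) measurable_const
    (Measurable.ite (measurableSet_lt measurable_const measurable_id) measurable_const
      measurable_const)

theorem norm_realSign_le (t : ℝ) : ‖(Real.sign t : ℂ)‖ ≤ 1 := by
  rcases Real.sign_apply_eq t with h | h | h <;> simp [h]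

/-- The function `e^{-x²/2} x ^ a`. -/
noncomputable def gaussMonomial (a : ℕ) (x : ℝ) : ℂ := (Real.exp (-x ^ 2 / 2) : ℂ) * x ^ a

theorem integrable_gaussMonomial (a : ℕ) : Integrable (gaussMonomial a) := by
  have h := (integrable_rpow_mul_exp_neg_mul_sq (b := 1 / 2) (by norm_num) (s := a)
    (by linarith [(Nat.cast_nonneg a : (0 : ℝ) ≤ a)])).ofReal (𝕜 := ℂ)
  refine h.congr (Filter.Eventually.of_forall fun x => ?_)
  have e : -(1 / 2) * x ^ 2 = -x ^ 2 / 2 := by ring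
  simp only [gaussMonomial, Real.rpow_natCast, e]
  rw [mul_comm]
  simp

/-- Up to sign, the derivative is the weighted polynomial `z ^ (b + 1) - b z ^ (b - 1)`, so
`integral_mul_sign` applies to it. -/
theorem hasDerivAt_gaussMonomial (b : ℕ) (x : ℝ) :
    HasDerivAt (gaussMonomial b)
      (-(gaussMonomial (b + 1) x - b * gaussMonomial (b - 1) x)) x := by
  have h1 : HasDerivAt (fun x : ℝ => (Real.exp (-x ^ 2 / 2) : ℂ))
      ((Real.exp (-x ^ 2 / 2) * -x : ℝ) : ℂ) x := by
    have := ((((hasDerivAt_id x).fun_pow 2).fun_neg.div_const 2).exp).ofReal_comp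
    exact this.congr_deriv (by simp; ring)
  have h2 := h1.fun_mul ((hasDerivAt_id x).ofReal_comp.fun_pow b)
  refine h2.congr_deriv ?_
  simp only [gaussMonomial, id]
  push_cast
  ring

/-- The sign kernel inverts `d/dx` up to the factor `2`. -/
theorem integral_mul_sign {φ φ' : ℝ → ℂ} (hd : ∀ x, HasDerivAt φ (φ' x) x)
    (hφ : Integrable φ) (hφ' : Integrable φ') (x : ℝ) :
    ∫ y, φ' y * (Real.sign (y - x) : ℂ) = -2 * φ x := by
  have hi : Integrable fun y => φ' y * (Real.sign (y - x) : ℂ) :=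
    hφ'.mul_bdd (Complex.measurable_ofReal.comp
        (measurable_realSign.comp (measurable_id.sub_const x))).aestronglyMeasurable
      (Filter.Eventually.of_forall fun y => norm_realSign_le _)
  rw [← intervalIntegral.integral_Iic_add_Ioi (b := x) hi.integrableOn hi.integrableOn]
  have h1 : ∫ y in Set.Iic x, φ' y * (Real.sign (y - x) : ℂ) = -φ x := by
    -- The endpoint is dropped because the sign is `0`, not `-1`, at `y = x`.
    rw [integral_Iic_eq_integral_Iio, setIntegral_congr_fun (g := fun y => -φ' y)
      measurableSet_Iio (fun y (hy : y < x) => by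
        simp only [Real.sign_of_neg (sub_neg.2 hy)]; simp), integral_neg,
      ← integral_Iic_eq_integral_Iio]
    have := integral_Iic_of_hasDerivAt_of_tendsto' (a := x) (fun y _ => hd y) hφ'.integrableOn
      (tendsto_zero_of_hasDerivAt_of_integrableOn_Iic (a := x) (fun y _ => hd y)
        hφ'.integrableOn hφ.integrableOn)
    rw [this, sub_zero]
  have h2 : ∫ y in Set.Ioi x, φ' y * (Real.sign (y - x) : ℂ) = -φ x := by
    rw [setIntegral_congr_fun (g := φ') measurableSet_Ioi (fun y (hy : x < y) => by
      simp only [Real.sign_of_pos (sub_pos.2 hy)]; simp)]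
    have := integral_Ioi_of_hasDerivAt_of_tendsto' (a := x) (fun y _ => hd y) hφ'.integrableOn
      (tendsto_zero_of_hasDerivAt_of_integrableOn_Ioi (a := x) (fun y _ => hd y)
        hφ'.integrableOn hφ.integrableOn)
    rw [this, zero_sub]
  rw [h1, h2]
  ring

theorem sqrt_ginWeight_mul (x y : ℝ) : Real.sqrt (ginWeight x * ginWeight y) =
    Real.exp (-x ^ 2 / 2) * Real.exp (-y ^ 2 / 2) := by
  rw [ginWeight_ofReal, ginWeight_ofReal, ← Real.exp_add, ← Real.exp_add, ← Real.exp_half]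
  congr 1
  ring

theorem skewRealIntegrand_pow (a b : ℕ) (x y : ℝ) :
    skewRealIntegrand (· ^ a) (· ^ b) x y =
      gaussMonomial a x * gaussMonomial b y * (Real.sign (y - x) : ℂ) := by
  rw [skewRealIntegrand, sqrt_ginWeight_mul, gaussMonomial, gaussMonomial]
  push_cast
  ring

theorem skewIntegrable_pow (a b : ℕ) : SkewIntegrable (· ^ a) (· ^ b) := by
  constructor
  · simp only [skewRealIntegrand_pow]
    exact ((integrable_gaussMonomial a).mul_prod (integrable_gaussMonomial b)).mul_bdd
      (Complex.measurable_ofReal.comp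
        (measurable_realSign.comp (measurable_snd.sub measurable_fst))).aestronglyMeasurable
      (Filter.Eventually.of_forall fun y => norm_realSign_le _)
  · refine ((integrableOn_ginWeight_conjMonomial a b).sub
      (integrableOn_ginWeight_conjMonomial b a)).congr
        (Filter.Eventually.of_forall fun z => ?_)
    simp only [skewComplexIntegrand, conjMonomial, Pi.sub_apply]
    ring

theorem skewRealIntegrand_swap (f g : ℂ → ℂ) (x y : ℝ) :
    skewRealIntegrand g f x y = -skewRealIntegrand f g y x := by
  have h : Real.sign (y - x) = -Real.sign (x - y) := by
    rw [← Real.sign_neg, neg_sub]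
  rw [skewRealIntegrand, skewRealIntegrand, h, mul_comm (ginWeight x)]
  push_cast
  ring

theorem skewComplexIntegrand_swap (f g : ℂ → ℂ) (z : ℂ) :
    skewComplexIntegrand g f z = -skewComplexIntegrand f g z := by
  rw [skewComplexIntegrand, skewComplexIntegrand]
  ring

theorem SkewIntegrable.swap {f g : ℂ → ℂ} (h : SkewIntegrable f g) : SkewIntegrable g f := by
  constructor
  · simp only [skewRealIntegrand_swap f g]
    exact h.1.swap.fun_neg
  · simp only [funext (skewComplexIntegrand_swap f g)]
    exact h.2.fun_neg

/-- Integrability licenses the exchange of the iterated integrals. -/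
theorem skewInner_swap {f g : ℂ → ℂ} (h : SkewIntegrable f g) :
    skewInner g f = -skewInner f g := by
  rw [skewInner, skewInner]
  simp only [skewRealIntegrand_swap f g, skewComplexIntegrand_swap f g, integral_neg]
  rw [integral_integral_swap (f := fun x y => skewRealIntegrand f g x y) h.1]
  ring

theorem SkewIntegrable.sub_const_mul_right {f g₁ g₂ : ℂ → ℂ} (h₁ : SkewIntegrable f g₁)
    (h₂ : SkewIntegrable f g₂) (c : ℂ) : SkewIntegrable f fun z => g₁ z - c * g₂ z := by
  constructor
  · refine (h₁.1.sub (h₂.1.const_mul c)).congr (Filter.Eventually.of_forall fun q => ?_)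
    simp only [skewRealIntegrand, Pi.sub_apply]
    ring
  · refine (h₁.2.sub (h₂.2.const_mul c)).congr (Filter.Eventually.of_forall fun q => ?_)
    simp only [skewComplexIntegrand, Pi.sub_apply]
    ring

/-- Functions of equal parity are skew-orthogonal. -/
theorem skewInner_eq_zero_of_parity {f g : ℂ → ℂ} (h : ∀ z w, f (-z) * g (-w) = f z * g w) :
    skewInner f g = 0 := by
  have h1 : ∀ x y, skewRealIntegrand f g (-x) (-y) = -skewRealIntegrand f g x y := by
    intro x y
    have hs : Real.sign (-y - -x) = -Real.sign (y - x) := by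
      rw [← Real.sign_neg]; congr 1; ring
    have hf := h x y
    simp only [skewRealIntegrand, hs, ginWeight_ofReal, neg_sq]
    push_cast
    linear_combination -(Real.sqrt (Real.exp (-x ^ 2) * Real.exp (-y ^ 2)) : ℂ) *
      (Real.sign (y - x) : ℂ) * hf
  have hR : ∫ x : ℝ, ∫ y : ℝ, skewRealIntegrand f g x y = 0 := by
    have e := integral_neg_eq_self (fun x : ℝ => ∫ y : ℝ, skewRealIntegrand f g x y) volume
    have e2 : ∀ x : ℝ, ∫ y : ℝ, skewRealIntegrand f g (-x) y =
        -∫ y : ℝ, skewRealIntegrand f g x y := fun x => by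
      rw [← integral_neg_eq_self, ← integral_neg]
      simp only [h1]
    simp only [e2, integral_neg] at e
    exact self_eq_neg.1 e.symm
  -- Reflection in the imaginary axis preserves the half plane and the weight, whereas `z ↦ -z`
  -- would leave the half plane.
  have h2 : ∀ z : ℂ, skewComplexIntegrand f g (-starRingEnd ℂ z) =
      -skewComplexIntegrand f g z := by
    intro z
    have hw : ginWeight (-starRingEnd ℂ z) = ginWeight z := by
      simp [ginWeight]
    rw [skewComplexIntegrand, hw, skewComplexIntegrand, map_neg, Complex.conj_conj]
    linear_combination (ginWeight z : ℂ) * (h (starRingEnd ℂ z) z - h z (starRingEnd ℂ z))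
  have hC : ∫ z in {z : ℂ | 0 < z.im}, skewComplexIntegrand f g z = 0 := by
    let T : ℂ ≃ₗᵢ[ℝ] ℂ := Complex.conjLIE.trans (LinearIsometryEquiv.neg ℝ)
    have hT : ∀ z, T z = -starRingEnd ℂ z := fun z => rfl
    have e := T.measurePreserving.setIntegral_preimage_emb T.toHomeomorph.measurableEmbedding
      (skewComplexIntegrand f g) {z : ℂ | 0 < z.im}
    have hS : T ⁻¹' {z : ℂ | 0 < z.im} = {z : ℂ | 0 < z.im} := by
      ext z; simp [hT]
    simp only [hS, hT, h2, integral_neg] at e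
    exact self_eq_neg.1 e.symm
  rw [skewInner, hR, hC]
  ring

/-- The boundary terms of Green's formula for `(a, b)` and `(b, a)` cancel the real integral. The
two bulk terms add up to a Gaussian moment over the whole plane, with constant `(2√2/√π) π =
2√(2π)`. -/
theorem skewInner_pow_sub (a b : ℕ) :
    skewInner (· ^ a) (fun z => z ^ (b + 1) - b * z ^ (b - 1)) =
      if a = b then ((2 * Real.sqrt (2 * Real.pi) * Real.Gamma (a + 1) : ℝ) : ℂ) else 0 := by
  have hinner : ∀ x : ℝ, ∫ y : ℝ,
      skewRealIntegrand (· ^ a) (fun z => z ^ (b + 1) - b * z ^ (b - 1)) x y =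
        2 * ((Real.exp (-x ^ 2) : ℂ) * x ^ (a + b)) := by
    intro x
    have e : ∀ y : ℝ, skewRealIntegrand (· ^ a) (fun z => z ^ (b + 1) - b * z ^ (b - 1)) x y =
        -gaussMonomial a x * (-(gaussMonomial (b + 1) y - b * gaussMonomial (b - 1) y) *
          (Real.sign (y - x) : ℂ)) := by
      intro y
      rw [skewRealIntegrand, sqrt_ginWeight_mul, gaussMonomial, gaussMonomial, gaussMonomial]
      push_cast
      ring
    have h2 : (Real.exp (-x ^ 2) : ℂ) = (Real.exp (-x ^ 2 / 2) : ℂ) * Real.exp (-x ^ 2 / 2) := by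
      rw [← Complex.ofReal_mul, ← Real.exp_add]
      congr 2
      ring
    simp only [e]
    rw [integral_const_mul, integral_mul_sign (hasDerivAt_gaussMonomial b)
      (integrable_gaussMonomial b) (((integrable_gaussMonomial (b + 1)).sub
        ((integrable_gaussMonomial (b - 1)).const_mul _)).fun_neg), h2, gaussMonomial,
      gaussMonomial, pow_add]
    ring
  have hC : ∫ z in {z : ℂ | 0 < z.im},
      skewComplexIntegrand (· ^ a) (fun z => z ^ (b + 1) - b * z ^ (b - 1)) z =
      ginMoment a (b + 1) - b * ginMoment a (b - 1) -
        (ginMoment (b + 1) a - b * ginMoment (b - 1) a) := by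
    have i := fun a b => integrableOn_ginWeight_conjMonomial a b
    have i1 := (i a (b + 1)).sub ((i a (b - 1)).const_mul (b : ℂ))
    have i2 := (i (b + 1) a).sub ((i (b - 1) a).const_mul (b : ℂ))
    unfold ginMoment
    rw [← integral_const_mul, ← integral_const_mul,
      ← integral_sub' (i a (b + 1)) ((i a (b - 1)).const_mul (b : ℂ)),
      ← integral_sub' (i (b + 1) a) ((i (b - 1) a).const_mul (b : ℂ)), ← integral_sub' i1 i2]
    refine integral_congr_ae (Filter.Eventually.of_forall fun z => ?_)
    simp only [skewComplexIntegrand, conjMonomial, Pi.sub_apply]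
    ring
  rw [skewInner, hC]
  simp only [hinner]
  -- This brings the swapped moments to the form in which Green's formula applies to both halves.
  rw [integral_const_mul, ginMoment_re_relation b a]
  have r1 := ginMoment_im_relation a b
  have r2 := ginMoment_im_relation b a
  rw [add_comm b a] at r2
  have hs := integral_upperHalfPlane_add_swap a b
  have hk : (2 * Real.sqrt 2 / Real.sqrt Real.pi : ℝ) * (Real.pi * Real.Gamma (a + 1)) =
      2 * Real.sqrt (2 * Real.pi) * Real.Gamma (a + 1) := by
    have : Real.sqrt Real.pi ≠ 0 := by positivity
    rw [Real.sqrt_mul (by norm_num)]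
    field_simp
    rw [Real.sq_sqrt Real.pi_pos.le]
  rw [← hk]
  split_ifs at hs ⊢ with hab
  · rw [Complex.ofReal_mul (2 * Real.sqrt 2 / Real.sqrt Real.pi)]
    linear_combination r1 + r2 + (2 * Real.sqrt 2 / Real.sqrt Real.pi : ℝ) * hs
  · rw [Complex.ofReal_zero] at hs
    linear_combination r1 + r2 + (2 * Real.sqrt 2 / Real.sqrt Real.pi : ℝ) * hs

/-! ### Skew orthogonality of the GinOE polynomials. -/

theorem exists_monic_ginOEPoly (m : ℕ) :
    ∃ q : Polynomial ℂ, q.Monic ∧ q.natDegree = m ∧ ∀ z, ginOEPoly m z = q.eval z := by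
  obtain ⟨n, rfl | rfl⟩ := m.even_or_odd'
  · exact ⟨.X ^ (2 * n), Polynomial.monic_X_pow _, Polynomial.natDegree_X_pow _,
      fun z => by simp [ginOEPoly_even]⟩
  · have hX : (Polynomial.X ^ (2 * n + 1) : Polynomial ℂ).natDegree = 2 * n + 1 :=
      Polynomial.natDegree_X_pow _
    have hlt : (Polynomial.C (2 * n : ℂ) * Polynomial.X ^ (2 * n - 1)).natDegree <
        (Polynomial.X ^ (2 * n + 1) : Polynomial ℂ).natDegree := by
      rw [hX]
      exact (Polynomial.natDegree_C_mul_X_pow_le _ _).trans_lt (by omega)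
    refine ⟨Polynomial.X ^ (2 * n + 1) - Polynomial.C (2 * n : ℂ) * Polynomial.X ^ (2 * n - 1),
      (Polynomial.monic_X_pow _).sub_of_left (Polynomial.degree_lt_degree hlt), ?_,
      fun z => ?_⟩
    · rw [Polynomial.natDegree_sub_eq_left_of_natDegree_lt hlt, hX]
    · rw [ginOEPoly_odd]
      simp

theorem ginOEPoly_even_eq (n : ℕ) : ginOEPoly (2 * n) = (· ^ (2 * n)) :=
  funext (ginOEPoly_even n)

theorem ginOEPoly_odd_eq (n : ℕ) : ginOEPoly (2 * n + 1) =
    fun z => z ^ (2 * n + 1) - ((2 * n : ℕ) : ℂ) * z ^ (2 * n - 1) := by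
  ext z
  rw [ginOEPoly_odd]
  push_cast
  rfl

theorem skewIntegrable_pow_ginOEPoly (a m : ℕ) : SkewIntegrable (· ^ a) (ginOEPoly m) := by
  obtain ⟨n, rfl | rfl⟩ := m.even_or_odd'
  · rw [ginOEPoly_even_eq]
    exact skewIntegrable_pow _ _
  · rw [ginOEPoly_odd_eq]
    exact (skewIntegrable_pow _ _).sub_const_mul_right (skewIntegrable_pow _ _) _

theorem skewIntegrable_ginOEPoly (j m : ℕ) : SkewIntegrable (ginOEPoly j) (ginOEPoly m) := by
  obtain ⟨n, rfl | rfl⟩ := m.even_or_odd'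
  · rw [ginOEPoly_even_eq]
    exact (skewIntegrable_pow_ginOEPoly _ _).swap
  · rw [ginOEPoly_odd_eq]
    exact (skewIntegrable_pow_ginOEPoly _ _).swap.sub_const_mul_right
      (skewIntegrable_pow_ginOEPoly _ _).swap _

theorem ginOEPoly_even_neg (n : ℕ) (z : ℂ) : ginOEPoly (2 * n) (-z) = ginOEPoly (2 * n) z := by
  simp [ginOEPoly_even, pow_mul]

theorem ginOEPoly_odd_neg (n : ℕ) (z : ℂ) :
    ginOEPoly (2 * n + 1) (-z) = -ginOEPoly (2 * n + 1) z := by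
  rcases n with - | n
  · rw [ginOEPoly_odd, ginOEPoly_odd]
    simp
  · have h : Odd (2 * (n + 1) - 1) := ⟨n, by omega⟩
    rw [ginOEPoly_odd, ginOEPoly_odd, h.neg_pow, (odd_two_mul_add_one (n + 1)).neg_pow]
    ring

theorem skewInner_even_odd (j k : ℕ) : skewInner (ginOEPoly (2 * j)) (ginOEPoly (2 * k + 1)) =
    if j = k then ((2 * Real.sqrt (2 * Real.pi) * Real.Gamma (2 * j + 1) : ℝ) : ℂ) else 0 := by
  rw [ginOEPoly_even_eq, ginOEPoly_odd_eq, skewInner_pow_sub]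
  simp

theorem isSkewOrthogonal_ginOEPoly : IsSkewOrthogonal ginOEPoly
    fun j => 2 * Real.sqrt (2 * Real.pi) * Real.Gamma (2 * j + 1) where
  monic := exists_monic_ginOEPoly
  integrable := skewIntegrable_ginOEPoly
  even_even j k := skewInner_eq_zero_of_parity fun z w => by
    rw [ginOEPoly_even_neg, ginOEPoly_even_neg]
  odd_odd j k := skewInner_eq_zero_of_parity fun z w => by
    rw [ginOEPoly_odd_neg, ginOEPoly_odd_neg, neg_mul_neg]
  even_odd := skewInner_even_odd
  odd_even j k := by
    rw [skewInner_swap (skewIntegrable_ginOEPoly _ _), skewInner_even_odd]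
    split_ifs <;> simp

theorem propositionP2p4 :
    -- sign-symmetric random matrices
    (∀ {Ω : Type*} [MeasurableSpace Ω] (μ : Measure Ω) [IsProbabilityMeasure μ] (n : ℕ)
      (G : Ω → Matrix (Fin (2 * n)) (Fin (2 * n)) ℂ),
      SignSymmetric μ G → AveragesExist μ G →
        Integrable (fun ω => (G ω ^ 2).trace) μ ∧
        ∀ z : ℂ, evenAverage μ G z = z ^ (2 * n) ∧
          oddAverage μ G z =
            z ^ (2 * n + 1) - (∫ ω, (G ω ^ 2).trace ∂μ) * z ^ (2 * n - 1)) ∧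
    -- GinOE: the averages
    (∀ n : ℕ,
      AveragesExist (ginOE (2 * n)) (toComplexMatrix (N := 2 * n)) ∧
      Integrable (fun A => (A ^ 2).trace) (ginOE (2 * n)) ∧
      ∫ A, (A ^ 2).trace ∂(ginOE (2 * n)) = 2 * n ∧
      ∀ z : ℂ, ginOEPoly (2 * n) z = z ^ (2 * n) ∧
        ginOEPoly (2 * n + 1) z = z ^ (2 * n + 1) - 2 * n * z ^ (2 * n - 1) ∧
        ginOEPoly (2 * n + 1) z =
          -Complex.exp (z ^ 2 / 2) *
            deriv (fun w : ℂ => Complex.exp (-w ^ 2 / 2) * ginOEPoly (2 * n) w) z) ∧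
    -- GinOE: skew orthogonality and skew norms
    ∃ r : ℕ → ℝ, IsSkewOrthogonal ginOEPoly r ∧
      ∀ n : ℕ, 1 ≤ n →
        r (n - 1) = 2 * Real.sqrt (2 * Real.pi) * Real.Gamma (2 * n - 1) := by
  refine ⟨fun μ _ n G hs hG => ?_, fun n => ⟨averagesExist_ginOE _, ?_, ?_, fun z =>
    ⟨ginOEPoly_even n z, ginOEPoly_odd n z, ginOEPoly_odd_eq_deriv n z⟩⟩,
    _, isSkewOrthogonal_ginOEPoly, fun n hn => ?_⟩
  · obtain ⟨h1, -, h3⟩ := hs.averages hG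
    refine ⟨h1, fun z => ⟨(h3 z).1, ?_⟩⟩
    rw [oddAverage, (h3 z).1, (h3 z).2]
    ring
  · have := ((signSymmetric_ginOE (2 * n)).averages (averagesExist_ginOE _)).1
    simp only [trace_toComplexMatrix_sq] at this
    simpa using this.re
  · have := integral_trace_sq_ginOE (2 * n)
    simp only [trace_toComplexMatrix_sq, integral_complex_ofReal] at this
    exact_mod_cast this
  · congr 2
    rw [Nat.cast_sub hn]
    push_cast
    ring
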